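/- Let $\mathcal T=\{t_0,\dots,t_K\}\subset\mathbb R$ be a finite set of treatment levels, $X$ a random vector with values in $\mathcal D\subseteq\mathbb R^d$, $T$ a random treatment in $\mathcal T$, and $Y(t)$, $t\in\mathcal T$, the potential outcomes. Assume: (a) overlap: for some $r_{\min}>0$, $\mathbb P(T=t\mid X)\ge r_{\min}$ almost surely for every $t\in\mathcal T$; (b) $Y(t)=f(t,X)+\varepsilon(t)$, where the $\varepsilon(t)$, $t\in\mathcal T$, are i.i.d. $\mathcal N(0,\sigma^2)$ and (jointly) independent of $(T,X)$; (c) $f(t,x)=\mathbf f(x)^\top\beta_t$ for all $t\in\mathcal T$ and $x\in\mathcal D$, where $\mathbf f=(f_0,\dots,f_{p-1})^\top$ consists of bounded (measurable) basis functions and $\beta_t\in\mathbb R^p$; the Gram matrix $\mathbb E[\mathbf f(X)\mathbf f(X)^\top]$ is invertible. Let $(X_i,T_i,Y_{\mathrm{obs},i})_{i\ge1}$ be i.i.d. copies of $(X,T,Y(T))$, let $t_k\ne t_0$ in $\mathcal T$, and put $\beta^*_k=\beta_{t_k}-\beta_{t_0}$ and $\rho(t)=\mathbb P(T=t)$. For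 a sample of size $n$ let $S_t=\{i\le n: T_i=t\}$ and let $H_t$ be the matrix with rows $\mathbf f(X_i)^\top$, $i\in S_t$. OLS regression of $(z_i)$ on $S_t$ gives the coefficients $(H_t^\top H_t)^{-1}H_t^\top (z_i)_{i\in S_t}$; let $\widehat\beta_t$ be the coefficients for $z_i=Y_{\mathrm{obs},i}$. (Where $H_t^\top H_t$ is singular, read its inverse as $0$.) The T-learner's estimator is $\widehat\beta^{T}=\widehat\beta_{t_k}-\widehat\beta_{t_0}$. The naive X-learner computes $\widehat\beta^{(k)}$ by OLS of $Y_{\mathrm{obs},i}-\mathbf f(X_i)^\top\widehat\beta_{t_0}$ on $S_{t_k}$ and $\widehat\beta^{(0)}$ by OLS of $\mathbf f(X_i)^\top\widehat\beta_{t_k}-Y_{\mathrm{obs},i}$ on $S_{t_0}$. With a (possibly data-dependent) propensity estimate $\widehat r>0$ it uses, at $x\in\mathcal D$, the coefficients $$\widehat\beta^{X}(x)=\frac{\widehat r(t_k,x)}{\widehat r(t_k,x)+\widehat r(t_0,x)}\widehat\beta^{(k)}+\frac{\widehat r(t_0,x)}{\widehat r(t_k,x)+\widehat r(t_0,x)}\widehat\beta^{(0)},$$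 and estimates the CATE by $\widehat\tau^{X}(x)=\mathbf f(x)^\top\widehat\beta^X(x)$; the T-learner estimates it by $\widehat\tau^{T}(x)=\mathbf f(x)^\top\widehat\beta_{t_k}-\mathbf f(x)^\top\widehat\beta_{t_0}$. Let $G_n$ be the event that $H_{t_k}$ and $H_{t_0}$ have full column rank $p$. Then: 1. $\mathbb E[Y(t_k)-Y(t_0)\mid X]=\mathbf f(X)^\top\beta^*_k$ almost surely, and almost surely $G_n$ occurs for all large $n$. 2. On $G_n$ the two learners coincide exactly: $\widehat\beta^{(k)}=\widehat\beta^{(0)}=\widehat\beta^{T}$, and $\widehat\beta^{X}(x)=\widehat\beta^{T}$ and $\widehat\tau^{X}(x)=\widehat\tau^{T}(x)=\mathbf f(x)^\top\widehat\beta^{T}$ for all $x\in\mathcal D$. 3. Each of the estimators $\widehat\beta\in\{\widehat\beta^{T},\widehat\beta^{(k)},\widehat\beta^{(0)},\widehat\beta^{X}(x)\ (x\in\mathcal D)\}$ is unbiased where it is defined: for every $n$, almost surely on $G_n$, the conditional law of $\widehat\beta$ given $(X_i,T_i)_{i\le n}$ has a mean, equal to $\beta^*_k$; and if $\widehat\beta\,\mathbf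 1_{G_n}$ is integrable then $\mathbb E[\widehat\beta\,\mathbf 1_{G_n}]=\mathbb P(G_n)\beta^*_k$. 4. Each of these estimators is asymptotically normal with asymptotic covariance $\mathbf C/n$: $\sqrt n(\widehat\beta-\beta^*_k)$ converges in distribution to $\mathcal N(0,\mathbf C)$, where $$\mathbf C=\frac{\sigma^2}{\rho(t_k)}F_{t_k}^{-1}+\frac{\sigma^2}{\rho(t_0)}F_{t_0}^{-1},\qquad F_t=\mathbb E[\mathbf f(X)\mathbf f(X)^\top\mid T=t].$$ 5. $\rho(t)>0$ for all $t\in\mathcal T$, the matrices $F_{t_k}$ and $F_{t_0}$ are positive definite, and whenever $c>0$ is a lower bound for the eigenvalues of both, all entries satisfy $$|\mathbf C_{ij}|\le\frac{\sigma^2}{c}\Big(\frac1{\rho(t_k)}+\frac1{\rho(t_0)}\Big).$$ Thus $\mathbf C_{ij}=\mathcal O\big(1/\rho(t_k)+1/\rho(t_0)\big)$ with a constant that depends only on $\sigma^2$ and on $c$. -/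

import Mathlib

open MeasureTheory ProbabilityTheory Filter Topology
open scoped NNReal ENNReal Matrix

noncomputable section

namespace MetaLearner

/-! ### Least squares and the two meta-learners, as functions of a data set

A data set of size `n` consists of covariates `x i`, treatments `w i` and outcomes `y i`,
for `i : Fin n`. The basis functions are `f j`, for `j : Fin p`. -/

/-- The ordinary least squares coefficients `(Hᵀ H)⁻¹ Hᵀ z` of the regression of `z` on the columns
of `H`. The formula is meaningful when `H` has full column rank. -/
def ols {ι : Type*} [Fintype ι] {p : ℕ} (H : Matrix ι (Fin p) ℝ) (z : ι → ℝ) :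
    EuclideanSpace ℝ (Fin p) :=
  WithLp.toLp 2 ((Hᵀ * H)⁻¹ *ᵥ (Hᵀ *ᵥ z))

/-- The linear predictor `f(x)ᵀ b`. -/
def predict {V : Type*} {p : ℕ} (f : Fin p → V → ℝ) (b : EuclideanSpace ℝ (Fin p)) (x : V) : ℝ :=
  ∑ j, f j x * b j

section Learners

variable {V 𝒯 : Type*} [DecidableEq 𝒯] {p n : ℕ}

/-- The set `S_t` of the units that received treatment `t`. -/
abbrev TreatmentGroup (w : Fin n → 𝒯) (t : 𝒯) : Type := {i : Fin n // w i = t}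

/-- The regression matrix `(f_j(x_i))` with one row for each unit of the group `S_t`. -/
def regressionMatrix (f : Fin p → V → ℝ) (x : Fin n → V) (w : Fin n → 𝒯) (t : 𝒯) :
    Matrix (TreatmentGroup w t) (Fin p) ℝ :=
  Matrix.of fun i j => f j (x i)

/-- The regression matrices of the groups `S_{tk}` and `S_{t0}` both have full column rank. -/
def FullRank (f : Fin p → V → ℝ) (tk t0 : 𝒯) (x : Fin n → V) (w : Fin n → 𝒯) : Prop :=
  (regressionMatrix f x w tk).rank = p ∧ (regressionMatrix f x w t0).rank = p

/-- The OLS coefficients of the regression of `(z i)` over the units of the group `S_t`. -/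
def groupOLS (f : Fin p → V → ℝ) (x : Fin n → V) (w : Fin n → 𝒯) (z : Fin n → ℝ) (t : 𝒯) :
    EuclideanSpace ℝ (Fin p) :=
  ols (regressionMatrix f x w t) fun i => z i

/-- The T-learner's OLS estimator of the CATE coefficients: the difference of the coefficients of
the two outcome regressions. -/
def tCoef (f : Fin p → V → ℝ) (tk t0 : 𝒯) (x : Fin n → V) (w : Fin n → 𝒯) (y : Fin n → ℝ) :
    EuclideanSpace ℝ (Fin p) :=
  groupOLS f x w y tk - groupOLS f x w y t0

/-- The T-learner's estimate of the CATE: the difference of the two fitted response surfaces. -/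
def tCATE (f : Fin p → V → ℝ) (tk t0 : 𝒯) (x : Fin n → V) (w : Fin n → 𝒯) (y : Fin n → ℝ)
    (v : V) : ℝ :=
  predict f (groupOLS f x w y tk) v - predict f (groupOLS f x w y t0) v

/-- First regression of the naive X-learner: on `S_{tk}`, regress the observed outcome minus the
response surface fitted on `S_{t0}`. -/
def xCoefTreated (f : Fin p → V → ℝ) (tk t0 : 𝒯) (x : Fin n → V) (w : Fin n → 𝒯)
    (y : Fin n → ℝ) : EuclideanSpace ℝ (Fin p) :=
  groupOLS f x w (fun i => y i - predict f (groupOLS f x w y t0) (x i)) tk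

/-- Second regression of the naive X-learner: on `S_{t0}`, regress the response surface fitted on
`S_{tk}` minus the observed outcome. -/
def xCoefControl (f : Fin p → V → ℝ) (tk t0 : 𝒯) (x : Fin n → V) (w : Fin n → 𝒯)
    (y : Fin n → ℝ) : EuclideanSpace ℝ (Fin p) :=
  groupOLS f x w (fun i => predict f (groupOLS f x w y tk) (x i) - y i) t0

/-- The coefficient vector of the naive X-learner at the covariate value `v`: the two coefficient
vectors averaged with the weights given by the propensity estimate `r`. -/
def xCoef (f : Fin p → V → ℝ) (tk t0 : 𝒯) (r : 𝒯 → V → ℝ) (x : Fin n → V) (w : Fin n → 𝒯)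
    (y : Fin n → ℝ) (v : V) : EuclideanSpace ℝ (Fin p) :=
  (r tk v / (r tk v + r t0 v)) • xCoefTreated f tk t0 x w y +
    (r t0 v / (r tk v + r t0 v)) • xCoefControl f tk t0 x w y

/-- The naive X-learner's estimate of the CATE: the two fitted surfaces averaged with the weights
given by the propensity estimate `r`. -/
def xCATE (f : Fin p → V → ℝ) (tk t0 : 𝒯) (r : 𝒯 → V → ℝ) (x : Fin n → V) (w : Fin n → 𝒯)
    (y : Fin n → ℝ) (v : V) : ℝ :=
  r tk v / (r tk v + r t0 v) * predict f (xCoefTreated f tk t0 x w y) v +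
    r t0 v / (r tk v + r t0 v) * predict f (xCoefControl f tk t0 x w y) v

end Learners

/-! ### The model -/

/-- The population model. `X` are the covariates with values in `D`, `T` is the treatment with
values in the finite set `𝒯` of treatment levels, `Y t` are the potential outcomes, `ε t` the
noises, `g` is the outcome function, `f` are the basis functions and `β t` the coefficients. -/
structure LinearOutcomeModel {Ω₀ : Type*} [MeasurableSpace Ω₀] (P : Measure Ω₀) {d p : ℕ}
    (𝒯 : Finset ℝ) (D : Set (EuclideanSpace ℝ (Fin d))) (X : Ω₀ → EuclideanSpace ℝ (Fin d))
    (T : Ω₀ → 𝒯) (Y ε : 𝒯 → Ω₀ → ℝ) (σ : ℝ≥0) (g : ℝ → EuclideanSpace ℝ (Fin d) → ℝ)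
    (f : Fin p → EuclideanSpace ℝ (Fin d) → ℝ) (β : 𝒯 → EuclideanSpace ℝ (Fin p)) : Prop where
  measurableSet_domain : MeasurableSet D
  measurable_X : Measurable X
  measurable_T : Measurable T
  mem_domain : ∀ᵐ ω ∂P, X ω ∈ D
  /-- Overlap: the generalized propensity score `P(T = t | X)` is bounded below. -/
  overlap : ∃ rmin : ℝ, 0 < rmin ∧
    ∀ t : 𝒯, ∀ᵐ ω ∂P, rmin ≤ (P⟦T ⁻¹' {t} | MeasurableSpace.comap X inferInstance⟧) ω
  outcome : ∀ t : 𝒯, ∀ᵐ ω ∂P, Y t ω = g t (X ω) + ε t ω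
  measurable_noise : ∀ t, Measurable (ε t)
  noise_law : ∀ t, P.map (ε t) = gaussianReal 0 (σ ^ 2)
  noise_indep : iIndepFun ε P
  noise_indep_design : IndepFun (fun ω t => ε t ω) (fun ω => (T ω, X ω)) P
  measurable_basis : ∀ j, Measurable (f j)
  bounded_basis : ∃ B : ℝ, ∀ j, ∀ x ∈ D, |f j x| ≤ B
  linear : ∀ t : 𝒯, ∀ x ∈ D, g t x = predict f (β t) x

/-- The observed units `(Xs i, Ts i, Ys i)` are independent, each distributed as `(X, T, Y(T))`. -/
structure IsObservedSample {Ω₀ Ω : Type*} [MeasurableSpace Ω₀] [MeasurableSpace Ω]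
    (P : Measure Ω₀) (μ : Measure Ω) {d : ℕ} {𝒯 : Finset ℝ}
    (X : Ω₀ → EuclideanSpace ℝ (Fin d)) (T : Ω₀ → 𝒯) (Y : 𝒯 → Ω₀ → ℝ)
    (Xs : ℕ → Ω → EuclideanSpace ℝ (Fin d)) (Ts : ℕ → Ω → 𝒯) (Ys : ℕ → Ω → ℝ) : Prop where
  measurable_Xs : ∀ i, Measurable (Xs i)
  measurable_Ts : ∀ i, Measurable (Ts i)
  measurable_Ys : ∀ i, Measurable (Ys i)
  indep : iIndepFun (fun i ω => (Xs i ω, Ts i ω, Ys i ω)) μ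
  identDistrib : ∀ i, IdentDistrib (fun ω => (Xs i ω, Ts i ω, Ys i ω))
    (fun ω => (X ω, T ω, Y (T ω) ω)) μ P

section Population

variable {Ω₀ V 𝒯 : Type*} [MeasurableSpace Ω₀] {p : ℕ}

/-- `ρ(t) = P(T = t)`. -/
def rho (P : Measure Ω₀) (T : Ω₀ → 𝒯) (t : 𝒯) : ℝ := P.real (T ⁻¹' {t})

/-- The Gram matrix `E[f_i(X) f_j(X)]`. -/
def gram (P : Measure Ω₀) (X : Ω₀ → V) (f : Fin p → V → ℝ) : Matrix (Fin p) (Fin p) ℝ :=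
  Matrix.of fun i j => ∫ ω, f i (X ω) * f j (X ω) ∂P

/-- The conditional Gram matrix `F_t = E[f_i(X) f_j(X) | T = t]`. -/
def condGram (P : Measure Ω₀) (X : Ω₀ → V) (T : Ω₀ → 𝒯) (f : Fin p → V → ℝ) (t : 𝒯) :
    Matrix (Fin p) (Fin p) ℝ :=
  gram (P[|T ⁻¹' {t}]) X f

/-- The matrix `C = σ² / ρ(tk) F_{tk}⁻¹ + σ² / ρ(t0) F_{t0}⁻¹`. -/
def asymptoticCov (P : Measure Ω₀) (X : Ω₀ → V) (T : Ω₀ → 𝒯) (f : Fin p → V → ℝ) (σ : ℝ≥0)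
    (tk t0 : 𝒯) : Matrix (Fin p) (Fin p) ℝ :=
  ((σ : ℝ) ^ 2 / rho P T tk) • (condGram P X T f tk)⁻¹ +
    ((σ : ℝ) ^ 2 / rho P T t0) • (condGram P X T f t0)⁻¹

end Population

/-! ### Properties of sequences of estimators -/

section Estimators

variable {Ω : Type*} [MeasurableSpace Ω] {p : ℕ}

/-- The estimators `b n`, which are meaningful on the events `G n`, are unbiased for `β` there:
given the design `Z n`, the conditional law of `b n` has mean `β` almost surely on `G n`; and the
expectation of `b n` on `G n` is the one of the constant `β` as soon as it exists. -/
def IsUnbiasedOn {𝒵 : ℕ → Type*} [∀ n, MeasurableSpace (𝒵 n)] (μ : Measure Ω) [IsFiniteMeasure μ]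
    (Z : ∀ n, Ω → 𝒵 n) (G : ℕ → Set Ω) (b : ℕ → Ω → EuclideanSpace ℝ (Fin p))
    (β : EuclideanSpace ℝ (Fin p)) : Prop :=
  ∀ n,
    (∀ᵐ ω ∂μ, ω ∈ G n →
      Integrable (fun v => v) (condDistrib (b n) (Z n) μ (Z n ω)) ∧
        ∫ v, v ∂(condDistrib (b n) (Z n) μ (Z n ω)) = β) ∧
    (IntegrableOn (b n) (G n) μ → ∫ ω in G n, b n ω ∂μ = μ.real (G n) • β)

/-- `√n (b n - β)` converges in distribution to the centred Gaussian law with covariance `C`: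
the estimator is asymptotically normal with asymptotic covariance matrix `C / n`. -/
def IsAsymptoticallyNormal (μ : Measure Ω) [IsProbabilityMeasure μ]
    (b : ℕ → Ω → EuclideanSpace ℝ (Fin p)) (β : EuclideanSpace ℝ (Fin p))
    (C : Matrix (Fin p) (Fin p) ℝ) : Prop :=
  C.PosSemidef ∧
    TendstoInDistribution (fun (n : ℕ) ω => √(n : ℝ) • (b n ω - β)) atTop
      (id : EuclideanSpace ℝ (Fin p) → EuclideanSpace ℝ (Fin p)) (fun _ => μ)
      (multivariateGaussian 0 C)

end Estimators

end MetaLearner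

end

/-! Least squares is linear in the response and, when `HᵀH` is invertible, returns `b` exactly from
a response of the form `f(x)ᵀb`. The X-learner subtracts a fitted surface of precisely this form, so
each of its regressions returns the T-learner's coefficients, and the weights sum to one
(`groupOLS_predict`, `xCoefTreated_eq_tCoef`, `xCoef_eq_tCoef`). The probabilistic claims then hold
for any measurable estimator that equals the T-learner on `G n`.

By `tCoef_eq_add_noise`, the estimation error is the T-learner applied to the residuals `Y -
f(X)ᵀβ_T`. Since the noises have one common law and are independent of `(T, X)`, the residuals are
i.i.d. centred Gaussian and independent of the whole design (`map_design_residual_eq`). Given a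
full-rank design, the error is therefore centred Gaussian with covariance `σ² (A_tk⁻¹ + A_t0⁻¹)`,
where `A_t = H_tᵀ H_t`. The zero mean gives unbiasedness.

For the limit no central limit theorem is needed. By the strong law, `A_t / n` tends almost surely
to `E[1_{T=t} f fᵀ] = ρ(t) F_t`, so the conditional characteristic functions converge almost surely
to that of `N(0, C)`; dominated convergence and Lévy's theorem conclude. Overlap gives `E[1_{T=t} f
fᵀ] ≥ r E[f fᵀ]` as quadratic forms, hence `ρ(t) F_t` is positive definite and `G n` eventually
occurs. The entry bound follows from `F ≥ c ⟹ F⁻¹ ≤ c⁻¹`. -/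

namespace MetaLearner

/-! ### Normal equations and the exact coincidence of the learners. -/

section Algebra

variable {V 𝒯 : Type*} [DecidableEq 𝒯] {p n : ℕ}

/-- The Gram matrix `HᵀH` of the regression in the group `S_t`, as a sum over all units. -/
def groupGram (f : Fin p → V → ℝ) (x : Fin n → V) (w : Fin n → 𝒯) (t : 𝒯) :
    Matrix (Fin p) (Fin p) ℝ :=
  Matrix.of fun j l => ∑ i, if w i = t then f j (x i) * f l (x i) else 0

/-- The vector `Hᵀz` of the regression in the group `S_t`, as a sum over all units. -/
def groupMoment (f : Fin p → V → ℝ) (x : Fin n → V) (w : Fin n → 𝒯) (z : Fin n → ℝ) (t : 𝒯) :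
    Fin p → ℝ :=
  fun j => ∑ i, if w i = t then f j (x i) * z i else 0

/-- The index type of the group depends on the random treatments. Sums over all units with an
indicator have a fixed index set, as measurability and the strong law require. -/
lemma sum_treatmentGroup (w : Fin n → 𝒯) (t : 𝒯) (h : Fin n → ℝ) :
    ∑ i : TreatmentGroup w t, h i = ∑ i, if w i = t then h i else 0 := by
  rw [← Finset.sum_filter]
  exact (Finset.sum_subtype (Finset.univ.filter fun i => w i = t) (by simp) h).symm

lemma transpose_mul_regressionMatrix (f : Fin p → V → ℝ) (x : Fin n → V) (w : Fin n → 𝒯) (t : 𝒯) :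
    (regressionMatrix f x w t)ᵀ * regressionMatrix f x w t = groupGram f x w t := by
  ext j l
  simp only [Matrix.mul_apply, Matrix.transpose_apply, regressionMatrix, Matrix.of_apply, groupGram]
  exact sum_treatmentGroup w t fun i => f j (x i) * f l (x i)

lemma transpose_mulVec_regressionMatrix (f : Fin p → V → ℝ) (x : Fin n → V) (w : Fin n → 𝒯)
    (z : Fin n → ℝ) (t : 𝒯) :
    ((regressionMatrix f x w t)ᵀ *ᵥ fun i => z i) = groupMoment f x w z t := by
  ext j
  simp only [Matrix.mulVec, dotProduct, Matrix.transpose_apply, regressionMatrix, Matrix.of_apply,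
    groupMoment]
  exact sum_treatmentGroup w t fun i => f j (x i) * z i

lemma groupOLS_eq (f : Fin p → V → ℝ) (x : Fin n → V) (w : Fin n → 𝒯) (z : Fin n → ℝ) (t : 𝒯) :
    groupOLS f x w z t = WithLp.toLp 2 ((groupGram f x w t)⁻¹ *ᵥ groupMoment f x w z t) := by
  rw [groupOLS, ols, transpose_mul_regressionMatrix, transpose_mulVec_regressionMatrix]

/-- `H` and `HᵀH` have the same rank over `ℝ`. Full rank thus becomes a determinant condition, which
is measurable in the design and stable under limits. -/
lemma rank_regressionMatrix_eq_iff (f : Fin p → V → ℝ) (x : Fin n → V) (w : Fin n → 𝒯) (t : 𝒯) :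
    (regressionMatrix f x w t).rank = p ↔ (groupGram f x w t).det ≠ 0 := by
  rw [← Matrix.rank_transpose_mul_self, transpose_mul_regressionMatrix, ← isUnit_iff_ne_zero,
    ← Matrix.isUnit_iff_isUnit_det]
  constructor
  · intro h
    rw [← Matrix.mulVec_surjective_iff_isUnit]
    have : LinearMap.range (groupGram f x w t).mulVecLin = ⊤ :=
      Submodule.eq_top_of_finrank_eq (by rw [← Matrix.rank, h]; simp)
    exact LinearMap.range_eq_top.1 this
  · intro h
    simpa using Matrix.rank_of_isUnit _ h

lemma fullRank_iff (f : Fin p → V → ℝ) (tk t0 : 𝒯) (x : Fin n → V) (w : Fin n → 𝒯) :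
    FullRank f tk t0 x w ↔ (groupGram f x w tk).det ≠ 0 ∧ (groupGram f x w t0).det ≠ 0 := by
  rw [FullRank, rank_regressionMatrix_eq_iff, rank_regressionMatrix_eq_iff]

lemma isSymm_groupGram (f : Fin p → V → ℝ) (x : Fin n → V) (w : Fin n → 𝒯) (t : 𝒯) :
    (groupGram f x w t).IsSymm := by
  ext j l
  simp [groupGram, mul_comm]

lemma groupMoment_predict (f : Fin p → V → ℝ) (x : Fin n → V) (w : Fin n → 𝒯) (z : Fin n → ℝ)
    (t : 𝒯) (b : EuclideanSpace ℝ (Fin p)) (hz : ∀ i, w i = t → z i = predict f b (x i)) :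
    groupMoment f x w z t = groupGram f x w t *ᵥ b.ofLp := by
  ext j
  simp only [groupMoment, Matrix.mulVec, dotProduct, groupGram, Matrix.of_apply, Finset.sum_mul]
  rw [Finset.sum_comm]
  refine Finset.sum_congr rfl fun i _ => ?_
  by_cases h : w i = t
  · simp [h, hz i h, predict, Finset.mul_sum, mul_assoc]
  · simp [h]

/-- The response is `Hb`, so the normal equations read `(HᵀH)⁻¹HᵀHb = b`. This exact reproduction
drives both the coincidence of the learners and the error formula. -/
lemma groupOLS_predict (f : Fin p → V → ℝ) (x : Fin n → V) (w : Fin n → 𝒯) (z : Fin n → ℝ)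
    (t : 𝒯) (b : EuclideanSpace ℝ (Fin p)) (hz : ∀ i, w i = t → z i = predict f b (x i))
    (hdet : (groupGram f x w t).det ≠ 0) :
    groupOLS f x w z t = b := by
  rw [groupOLS_eq, groupMoment_predict f x w z t b hz, Matrix.mulVec_mulVec,
    Matrix.nonsing_inv_mul _ (isUnit_iff_ne_zero.2 hdet), Matrix.one_mulVec]

lemma groupOLS_add (f : Fin p → V → ℝ) (x : Fin n → V) (w : Fin n → 𝒯) (z z' : Fin n → ℝ)
    (t : 𝒯) :
    groupOLS f x w (fun i => z i + z' i) t = groupOLS f x w z t + groupOLS f x w z' t := by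
  have h : groupMoment f x w (fun i => z i + z' i) t
      = groupMoment f x w z t + groupMoment f x w z' t := by
    ext j
    simp only [groupMoment, Pi.add_apply, ← Finset.sum_add_distrib]
    refine Finset.sum_congr rfl fun i _ => ?_
    split_ifs <;> ring
  rw [groupOLS_eq, groupOLS_eq, groupOLS_eq, h, Matrix.mulVec_add, WithLp.toLp_add]

lemma groupOLS_sub (f : Fin p → V → ℝ) (x : Fin n → V) (w : Fin n → 𝒯) (z z' : Fin n → ℝ)
    (t : 𝒯) :
    groupOLS f x w (fun i => z i - z' i) t = groupOLS f x w z t - groupOLS f x w z' t := by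
  rw [eq_sub_iff_add_eq, ← groupOLS_add]
  simp

lemma predict_sub (f : Fin p → V → ℝ) (b b' : EuclideanSpace ℝ (Fin p)) (v : V) :
    predict f (b - b') v = predict f b v - predict f b' v := by
  simp [predict, mul_sub, Finset.sum_sub_distrib]

/-- The surface fitted on the other group is linear in the basis, so regressing it on this group
returns its coefficients unchanged. -/
lemma xCoefTreated_eq_tCoef {f : Fin p → V → ℝ} {tk t0 : 𝒯} {x : Fin n → V} {w : Fin n → 𝒯}
    (h : FullRank f tk t0 x w) (y : Fin n → ℝ) :
    xCoefTreated f tk t0 x w y = tCoef f tk t0 x w y := by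
  rw [xCoefTreated, groupOLS_sub, tCoef, groupOLS_predict f x w _ tk _ (fun i _ => rfl)
    ((fullRank_iff ..).1 h).1]

lemma xCoefControl_eq_tCoef {f : Fin p → V → ℝ} {tk t0 : 𝒯} {x : Fin n → V} {w : Fin n → 𝒯}
    (h : FullRank f tk t0 x w) (y : Fin n → ℝ) :
    xCoefControl f tk t0 x w y = tCoef f tk t0 x w y := by
  rw [xCoefControl, groupOLS_sub, tCoef, groupOLS_predict f x w _ t0 _ (fun i _ => rfl)
    ((fullRank_iff ..).1 h).2]

lemma xCoef_eq_tCoef {f : Fin p → V → ℝ} {tk t0 : 𝒯} {x : Fin n → V} {w : Fin n → 𝒯}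
    (h : FullRank f tk t0 x w) (y : Fin n → ℝ) {r : 𝒯 → V → ℝ} {v : V} (hr : ∀ t, 0 < r t v) :
    xCoef f tk t0 r x w y v = tCoef f tk t0 x w y := by
  rw [xCoef, xCoefTreated_eq_tCoef h, xCoefControl_eq_tCoef h, ← add_smul, ← add_div,
    div_self (add_pos (hr tk) (hr t0)).ne', one_smul]

lemma xCATE_eq_predict {f : Fin p → V → ℝ} {tk t0 : 𝒯} {x : Fin n → V} {w : Fin n → 𝒯}
    (h : FullRank f tk t0 x w) (y : Fin n → ℝ) {r : 𝒯 → V → ℝ} {v : V} (hr : ∀ t, 0 < r t v) :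
    xCATE f tk t0 r x w y v = predict f (tCoef f tk t0 x w y) v := by
  rw [xCATE, xCoefTreated_eq_tCoef h, xCoefControl_eq_tCoef h, ← add_mul, ← add_div,
    div_self (add_pos (hr tk) (hr t0)).ne', one_mul]

lemma tCATE_eq_predict (f : Fin p → V → ℝ) (tk t0 : 𝒯) (x : Fin n → V) (w : Fin n → 𝒯)
    (y : Fin n → ℝ) (v : V) :
    tCATE f tk t0 x w y v = predict f (tCoef f tk t0 x w y) v := by
  rw [tCATE, tCoef, predict_sub]

/-- In a linear model, the estimation error of the T-learner is the T-learner applied to the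
noise. -/
lemma tCoef_eq_add_noise {f : Fin p → V → ℝ} {tk t0 : 𝒯} {x : Fin n → V} {w : Fin n → 𝒯}
    (h : FullRank f tk t0 x w) (y : Fin n → ℝ) (β : 𝒯 → EuclideanSpace ℝ (Fin p)) :
    tCoef f tk t0 x w y = (β tk - β t0) +
      tCoef f tk t0 x w (fun i => y i - predict f (β (w i)) (x i)) := by
  have hdet := (fullRank_iff ..).1 h
  rw [tCoef, tCoef, groupOLS_sub, groupOLS_sub,
    groupOLS_predict f x w (fun i => predict f (β (w i)) (x i)) tk (β tk)
      (fun i hi => by rw [hi]) hdet.1,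
    groupOLS_predict f x w (fun i => predict f (β (w i)) (x i)) t0 (β t0)
      (fun i hi => by rw [hi]) hdet.2]
  abel

/-- This is `‖Hb‖² = bᵀHᵀHb`; it evaluates the variance of the error below. -/
lemma sum_ite_predict_sq (f : Fin p → V → ℝ) (x : Fin n → V) (w : Fin n → 𝒯) (t : 𝒯)
    (b : EuclideanSpace ℝ (Fin p)) :
    ∑ i, (if w i = t then predict f b (x i) ^ 2 else 0)
      = b.ofLp ⬝ᵥ (groupGram f x w t *ᵥ b.ofLp) := by
  rw [← groupMoment_predict f x w (fun i => predict f b (x i)) t b fun _ _ => rfl]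
  simp only [dotProduct, groupMoment, Finset.mul_sum]
  rw [Finset.sum_comm]
  refine Finset.sum_congr rfl fun i _ => ?_
  split_ifs
  · rw [sq]
    nth_rw 1 [predict]
    rw [Finset.sum_mul]
    exact Finset.sum_congr rfl fun j _ => by ring
  · simp

/-- The OLS coefficients, tested against a vector, are a linear combination of the outcomes. -/
lemma dotProduct_groupOLS (f : Fin p → V → ℝ) (x : Fin n → V) (w : Fin n → 𝒯) (z : Fin n → ℝ)
    (t : 𝒯) (s : Fin p → ℝ) :
    s ⬝ᵥ (groupOLS f x w z t).ofLp
      = ∑ i, (if w i = t then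
          predict f (WithLp.toLp 2 ((groupGram f x w t)⁻¹ *ᵥ s)) (x i) else 0) * z i := by
  have hsymm : ((groupGram f x w t)⁻¹)ᵀ = (groupGram f x w t)⁻¹ := by
    rw [Matrix.transpose_nonsing_inv, (isSymm_groupGram f x w t).eq]
  rw [groupOLS_eq]
  change s ⬝ᵥ ((groupGram f x w t)⁻¹ *ᵥ groupMoment f x w z t) = _
  rw [Matrix.dotProduct_mulVec, ← Matrix.mulVec_transpose, hsymm]
  simp only [dotProduct, groupMoment, Finset.mul_sum]
  rw [Finset.sum_comm]
  refine Finset.sum_congr rfl fun i _ => ?_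
  split_ifs
  · simp only [predict, Finset.sum_mul]
    exact Finset.sum_congr rfl fun j _ => by ring
  · simp

end Algebra

/-! ### Measurability of the estimators in the data. -/

section Measurability

variable {α V 𝒯 : Type*} [MeasurableSpace α] [MeasurableSpace V] [MeasurableSpace 𝒯]
  [MeasurableSingletonClass 𝒯] [DecidableEq 𝒯] {p n : ℕ} {f : Fin p → V → ℝ}
  {x : α → Fin n → V} {w : α → Fin n → 𝒯} {z : α → Fin n → ℝ}

lemma measurable_det {A : α → Matrix (Fin p) (Fin p) ℝ} (hA : ∀ i j, Measurable fun a => A a i j) :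
    Measurable fun a => (A a).det := by
  simp only [Matrix.det_apply]
  fun_prop

/-- The inverse is `det⁻¹ • adjugate`, with `0⁻¹ = 0` covering singular matrices, so no restriction
to the full-rank event is needed. -/
lemma measurable_inv_apply {A : α → Matrix (Fin p) (Fin p) ℝ}
    (hA : ∀ i j, Measurable fun a => A a i j) (i j : Fin p) : Measurable fun a => (A a)⁻¹ i j := by
  simp only [Matrix.inv_def, Ring.inverse_eq_inv', Matrix.smul_apply, smul_eq_mul,
    Matrix.adjugate_apply]
  refine (measurable_det hA).inv.mul (measurable_det fun k l => ?_)
  by_cases h : k = j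
  · subst h
    simp
  · simpa [Matrix.updateRow_ne h] using hA k l

lemma measurable_groupGram (hf : ∀ j, Measurable (f j)) (hx : Measurable x) (hw : Measurable w)
    (t : 𝒯) (j l : Fin p) : Measurable fun a => groupGram f (x a) (w a) t j l := by
  simp only [groupGram, Matrix.of_apply]
  refine Finset.measurable_sum _ fun i _ => Measurable.ite ?_ ?_ measurable_const
  · exact measurable_pi_iff.1 hw i (measurableSet_singleton t)
  · exact ((hf j).comp (measurable_pi_iff.1 hx i)).mul ((hf l).comp (measurable_pi_iff.1 hx i))

lemma measurable_groupMoment (hf : ∀ j, Measurable (f j)) (hx : Measurable x) (hw : Measurable w)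
    (hz : Measurable z) (t : 𝒯) (j : Fin p) :
    Measurable fun a => groupMoment f (x a) (w a) (z a) t j := by
  simp only [groupMoment]
  refine Finset.measurable_sum _ fun i _ => Measurable.ite ?_ ?_ measurable_const
  · exact measurable_pi_iff.1 hw i (measurableSet_singleton t)
  · exact ((hf j).comp (measurable_pi_iff.1 hx i)).mul (measurable_pi_iff.1 hz i)

lemma measurable_groupOLS (hf : ∀ j, Measurable (f j)) (hx : Measurable x) (hw : Measurable w)
    (hz : Measurable z) (t : 𝒯) : Measurable fun a => groupOLS f (x a) (w a) (z a) t := by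
  simp only [groupOLS_eq]
  refine (PiLp.continuous_toLp 2 _).measurable.comp (measurable_pi_iff.2 fun j => ?_)
  simp only [Matrix.mulVec, dotProduct]
  exact Finset.measurable_sum _ fun l _ =>
    (measurable_inv_apply (measurable_groupGram hf hx hw t) j l).mul
      (measurable_groupMoment hf hx hw hz t l)

lemma measurable_predict (hf : ∀ j, Measurable (f j)) {b : α → EuclideanSpace ℝ (Fin p)}
    {v : α → V} (hb : Measurable b) (hv : Measurable v) :
    Measurable fun a => predict f (b a) (v a) := by
  simp only [predict]
  refine Finset.measurable_sum _ fun j _ => ((hf j).comp hv).mul ?_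
  exact (by fun_prop : Measurable fun b : EuclideanSpace ℝ (Fin p) => b j).comp hb

lemma measurable_tCoef (hf : ∀ j, Measurable (f j)) (hx : Measurable x) (hw : Measurable w)
    (hz : Measurable z) (tk t0 : 𝒯) : Measurable fun a => tCoef f tk t0 (x a) (w a) (z a) :=
  (measurable_groupOLS hf hx hw hz tk).sub (measurable_groupOLS hf hx hw hz t0)

lemma measurable_predict_groupOLS (hf : ∀ j, Measurable (f j)) (hx : Measurable x)
    (hw : Measurable w) (hz : Measurable z) (t : 𝒯) :
    Measurable fun a => fun i => predict f (groupOLS f (x a) (w a) (z a) t) (x a i) :=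
  measurable_pi_iff.2 fun i =>
    measurable_predict hf (measurable_groupOLS hf hx hw hz t) (measurable_pi_iff.1 hx i)

lemma measurable_xCoefTreated (hf : ∀ j, Measurable (f j)) (hx : Measurable x) (hw : Measurable w)
    (hz : Measurable z) (tk t0 : 𝒯) :
    Measurable fun a => xCoefTreated f tk t0 (x a) (w a) (z a) :=
  measurable_groupOLS hf hx hw (hz.sub (measurable_predict_groupOLS hf hx hw hz t0)) tk

lemma measurable_xCoefControl (hf : ∀ j, Measurable (f j)) (hx : Measurable x) (hw : Measurable w)
    (hz : Measurable z) (tk t0 : 𝒯) :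
    Measurable fun a => xCoefControl f tk t0 (x a) (w a) (z a) :=
  measurable_groupOLS hf hx hw ((measurable_predict_groupOLS hf hx hw hz tk).sub hz) t0

lemma measurable_xCoef (hf : ∀ j, Measurable (f j)) (hx : Measurable x) (hw : Measurable w)
    (hz : Measurable z) (tk t0 : 𝒯) {r : α → 𝒯 → V → ℝ} {v : V}
    (hr : ∀ t, Measurable fun a => r a t v) :
    Measurable fun a => xCoef f tk t0 (r a) (x a) (w a) (z a) v :=
  (((hr tk).div ((hr tk).add (hr t0))).smul (measurable_xCoefTreated hf hx hw hz tk t0)).add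
    (((hr t0).div ((hr tk).add (hr t0))).smul (measurable_xCoefControl hf hx hw hz tk t0))

lemma measurableSet_fullRank (hf : ∀ j, Measurable (f j)) (hx : Measurable x) (hw : Measurable w)
    (tk t0 : 𝒯) : MeasurableSet {a | FullRank f tk t0 (x a) (w a)} := by
  simp only [fullRank_iff]
  have h (t : 𝒯) : MeasurableSet {a | (groupGram f (x a) (w a) t).det ≠ 0} :=
    (measurable_det (measurable_groupGram hf hx hw t)) (measurableSet_singleton 0).compl
  exact (h tk).inter (h t0)

end Measurability

/-! ### Conditional laws and means given a design independent of the noise. -/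

section ConditionalLaw

variable {Ω 𝒵 𝓔 F : Type*} [MeasurableSpace Ω] [MeasurableSpace 𝒵] [MeasurableSpace 𝓔]
  [NormedAddCommGroup F] [CompleteSpace F] [MeasurableSpace F] [BorelSpace F]
  [SecondCountableTopology F]
  {μ : Measure Ω} [IsProbabilityMeasure μ] {ν : Measure 𝓔} [IsProbabilityMeasure ν]
  {Z : Ω → 𝒵} {E : Ω → 𝓔} {φ : 𝒵 × 𝓔 → F} {b : Ω → F} {A : Set 𝒵}

/-- The event concerns the first coordinate only: it is the rectangle `A ×ˢ univ`, and restricting a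
product measure to it restricts one factor. -/
lemma map_prod_restrict_eq (hZ : Measurable Z) (hE : Measurable E)
    (hlaw : μ.map (fun ω => (Z ω, E ω)) = (μ.map Z).prod ν) (hA : MeasurableSet A) :
    (μ.restrict (Z ⁻¹' A)).map (fun ω => (Z ω, E ω)) = ((μ.map Z).restrict A).prod ν := by
  have h : Z ⁻¹' A = (fun ω => (Z ω, E ω)) ⁻¹' (A ×ˢ Set.univ) := by
    ext; simp
  rw [h, ← Measure.restrict_map (hZ.prodMk hE) (hA.prod .univ), hlaw, ← Measure.prod_restrict,
    Measure.restrict_univ]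

/-- If `b = φ(Z, E)` on the event `Z ∈ A`, where `E` has law `ν` and is independent of `Z`, then
on this event the conditional law of `b` given `Z = z` is the law of `φ(z, ·)`. -/
lemma condDistrib_ae_eq_map_of_indep (hZ : Measurable Z) (hE : Measurable E) (hb : Measurable b)
    (hφ : Measurable φ) (hA : MeasurableSet A)
    (hlaw : μ.map (fun ω => (Z ω, E ω)) = (μ.map Z).prod ν)
    (hbφ : ∀ ω, Z ω ∈ A → b ω = φ (Z ω, E ω)) :
    ∀ᵐ ω ∂μ, Z ω ∈ A → condDistrib b Z μ (Z ω) = ν.map fun e => φ (Z ω, e) := by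
  have : IsProbabilityMeasure (μ.map Z) := Measure.isProbabilityMeasure_map hZ.aemeasurable
  let κ : Kernel 𝒵 F := (Kernel.id ×ₖ Kernel.const 𝒵 ν).map φ
  have : IsMarkovKernel κ := Kernel.IsMarkovKernel.map _ hφ
  have hκ (z : 𝒵) : κ z = ν.map fun e => φ (z, e) := by
    rw [Kernel.map_apply _ hφ, Kernel.prod_apply, Kernel.id_apply, Kernel.const_apply,
      Measure.dirac_prod, Measure.map_map hφ measurable_prodMk_left]
    rfl
  have h₁ : (μ.map Z).restrict A ⊗ₘ condDistrib b Z μ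
      = (μ.restrict (Z ⁻¹' A)).map fun ω => (Z ω, b ω) := by
    have hpre : Z ⁻¹' A = (fun ω => (Z ω, b ω)) ⁻¹' (A ×ˢ Set.univ) := by
      ext; simp
    rw [hpre, ← Measure.restrict_map (hZ.prodMk hb) (hA.prod .univ),
      ← compProd_map_condDistrib hb.aemeasurable]
    ext s hs
    rw [Measure.restrict_apply hs, Measure.compProd_apply hs,
      Measure.compProd_apply (hs.inter (hA.prod .univ)), ← lintegral_indicator hA]
    refine lintegral_congr fun z => ?_
    by_cases hz : z ∈ A
    · simp only [Set.indicator_of_mem hz]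
      congr 1
      ext
      simp [hz]
    · simp [hz]
  have h₂ : (μ.map Z).restrict A ⊗ₘ κ = (μ.restrict (Z ⁻¹' A)).map fun ω => (Z ω, b ω) := by
    have : (μ.restrict (Z ⁻¹' A)).map (fun ω => (Z ω, b ω))
        = ((μ.restrict (Z ⁻¹' A)).map fun ω => (Z ω, E ω)).map fun q => (q.1, φ q) := by
      rw [Measure.map_map (measurable_fst.prodMk hφ) (hZ.prodMk hE)]
      refine Measure.map_congr ?_
      filter_upwards [ae_restrict_mem (hZ hA)] with ω hω
      simp [hbφ ω hω]
    rw [this, map_prod_restrict_eq hZ hE hlaw hA]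
    ext s hs
    rw [Measure.compProd_apply hs, Measure.map_apply (measurable_fst.prodMk hφ) hs,
      Measure.prod_apply ((measurable_fst.prodMk hφ) hs)]
    refine lintegral_congr fun z => ?_
    have hm : Measurable fun e => φ (z, e) := hφ.comp measurable_prodMk_left
    rw [hκ, Measure.map_apply hm (measurable_prodMk_left hs)]
    rfl
  -- Both kernels disintegrate the law of `(Z, b)` on the event `Z ∈ A`; disintegrations are almost
  -- everywhere unique.
  have h := Kernel.ae_eq_of_compProd_eq (h₁.trans h₂.symm)
  have h' := (ae_restrict_iff' hA).1 h
  filter_upwards [ae_of_ae_map hZ.aemeasurable h'] with ω hω hA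
  rw [hω hA, hκ]

/-- Fubini, with a constant inner integral. Integrability has to be assumed: a constant conditional
mean does not control the size of `b`. -/
lemma setIntegral_eq_measureReal_smul_of_indep [NormedSpace ℝ F] (hZ : Measurable Z) (hE : Measurable E)
    (hφ : Measurable φ) (hA : MeasurableSet A)
    (hlaw : μ.map (fun ω => (Z ω, E ω)) = (μ.map Z).prod ν)
    (hbφ : ∀ ω, Z ω ∈ A → b ω = φ (Z ω, E ω)) {m : F}
    (hmean : ∀ z ∈ A, ∫ e, φ (z, e) ∂ν = m) (hint : IntegrableOn b (Z ⁻¹' A) μ) :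
    ∫ ω in Z ⁻¹' A, b ω ∂μ = μ.real (Z ⁻¹' A) • m := by
  have : IsProbabilityMeasure (μ.map Z) := Measure.isProbabilityMeasure_map hZ.aemeasurable
  have hcongr : b =ᵐ[μ.restrict (Z ⁻¹' A)] fun ω => φ (Z ω, E ω) := by
    filter_upwards [ae_restrict_mem (hZ hA)] with ω hω using hbφ ω hω
  have hmap := map_prod_restrict_eq hZ hE hlaw hA
  have hint' : Integrable φ (((μ.map Z).restrict A).prod ν) := by
    rw [← hmap, integrable_map_measure hφ.aestronglyMeasurable (hZ.prodMk hE).aemeasurable]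
    exact (integrable_congr hcongr).1 hint
  calc ∫ ω in Z ⁻¹' A, b ω ∂μ
      = ∫ ω in Z ⁻¹' A, φ (Z ω, E ω) ∂μ := integral_congr_ae hcongr
    _ = ∫ q, φ q ∂(((μ.map Z).restrict A).prod ν) := by
        rw [← hmap, integral_map (hZ.prodMk hE).aemeasurable hφ.aestronglyMeasurable]
    _ = ∫ z in A, ∫ e, φ (z, e) ∂ν ∂(μ.map Z) := integral_prod _ hint'
    _ = ∫ z in A, m ∂(μ.map Z) := setIntegral_congr_fun hA hmean
    _ = μ.real (Z ⁻¹' A) • m := by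
        rw [setIntegral_const, map_measureReal_apply hZ hA]

end ConditionalLaw

/-- An estimator that is a function of the design and of noises independent of the design is
unbiased as soon as it is so for each fixed value of the design. -/
lemma isUnbiasedOn_of_indep {Ω : Type*} [MeasurableSpace Ω] {p : ℕ} {𝒵 𝓔 : ℕ → Type*}
    [∀ n, MeasurableSpace (𝒵 n)] [∀ n, MeasurableSpace (𝓔 n)] {μ : Measure Ω}
    [IsProbabilityMeasure μ] {ν : ∀ n, Measure (𝓔 n)} [∀ n, IsProbabilityMeasure (ν n)]
    {Z : ∀ n, Ω → 𝒵 n} {E : ∀ n, Ω → 𝓔 n} {A : ∀ n, Set (𝒵 n)}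
    {φ : ∀ n, 𝒵 n × 𝓔 n → EuclideanSpace ℝ (Fin p)} {b : ℕ → Ω → EuclideanSpace ℝ (Fin p)}
    {β : EuclideanSpace ℝ (Fin p)}
    (hZ : ∀ n, Measurable (Z n)) (hE : ∀ n, Measurable (E n)) (hb : ∀ n, Measurable (b n))
    (hφ : ∀ n, Measurable (φ n)) (hA : ∀ n, MeasurableSet (A n))
    (hlaw : ∀ n, μ.map (fun ω => (Z n ω, E n ω)) = (μ.map (Z n)).prod (ν n))
    (hbφ : ∀ n ω, Z n ω ∈ A n → b n ω = φ n (Z n ω, E n ω))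
    (hmean : ∀ n, ∀ z ∈ A n, Integrable (fun e => φ n (z, e)) (ν n) ∧
      ∫ e, φ n (z, e) ∂(ν n) = β) :
    IsUnbiasedOn μ Z (fun n => Z n ⁻¹' A n) b β := by
  refine fun n => ⟨?_, setIntegral_eq_measureReal_smul_of_indep (hZ n) (hE n) (hφ n) (hA n)
    (hlaw n) (hbφ n) fun z hz => (hmean n z hz).2⟩
  filter_upwards [condDistrib_ae_eq_map_of_indep (hZ n) (hE n) (hb n) (hφ n) (hA n) (hlaw n)
    (hbφ n)] with ω hω hωA
  have hm : AEMeasurable (fun e => φ n (Z n ω, e)) (ν n) :=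
    ((hφ n).comp measurable_prodMk_left).aemeasurable
  rw [hω hωA]
  refine ⟨(integrable_map_measure aestronglyMeasurable_id hm).2 (hmean n _ hωA).1, ?_⟩
  exact (integral_map hm aestronglyMeasurable_id).trans (hmean n _ hωA).2

/-! ### Product laws under changes of the design and selection of noises. -/

section Law

variable {Ω 𝒵 𝒵' 𝓔 : Type*} [MeasurableSpace Ω] [MeasurableSpace 𝒵] [MeasurableSpace 𝒵']
  [MeasurableSpace 𝓔]

lemma map_comp_prod_of_map_eq_prod {μ : Measure Ω} {ρ : Measure 𝒵} {ν : Measure 𝓔} [SFinite ρ]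
    [IsProbabilityMeasure ν] {Z : Ω → 𝒵} {E : Ω → 𝓔} (hZ : Measurable Z) (hE : Measurable E)
    (hlaw : μ.map (fun ω => (Z ω, E ω)) = ρ.prod ν) {h : 𝒵 → 𝒵'} (hh : Measurable h) :
    μ.map (fun ω => (h (Z ω), E ω)) = (μ.map fun ω => h (Z ω)).prod ν := by
  have hfst : μ.map Z = ρ := by
    have := congrArg (Measure.map Prod.fst) hlaw
    rw [Measure.map_map measurable_fst (hZ.prodMk hE), Measure.map_fst_prod] at this
    rwa [measure_univ, one_smul] at this
  have h₁ : μ.map (fun ω => h (Z ω)) = ρ.map h := by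
    rw [← hfst, Measure.map_map hh hZ]
    rfl
  have h₂ : μ.map (fun ω => (h (Z ω), E ω))
      = (μ.map fun ω => (Z ω, E ω)).map (Prod.map h id) := by
    rw [Measure.map_map (hh.prodMap measurable_id) (hZ.prodMk hE)]
    rfl
  rw [h₂, hlaw, h₁, ← Measure.map_prod_map _ _ hh measurable_id, Measure.map_id]

/-- Selecting one of finitely many identically distributed noises by an index that is independent
of them produces a noise with the same law, independent of the index. -/
lemma map_prod_eval_eq_prod {ι : Type*} [Countable ι] [MeasurableSpace ι]
    [MeasurableSingletonClass ι] {P : Measure Ω} [IsProbabilityMeasure P] {ν : Measure 𝓔}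
    {Z : Ω → 𝒵} {T : 𝒵 → ι} {ε : ι → Ω → 𝓔} (hZ : Measurable Z) (hT : Measurable T)
    (hε : ∀ t, Measurable (ε t)) (hν : ∀ t, P.map (ε t) = ν)
    (hindep : IndepFun Z (fun ω t => ε t ω) P) :
    P.map (fun ω => (Z ω, ε (T (Z ω)) ω)) = (P.map Z).prod ν := by
  have hε' : Measurable fun ω t => ε t ω := measurable_pi_iff.2 hε
  have : IsProbabilityMeasure (P.map Z) := Measure.isProbabilityMeasure_map hZ.aemeasurable
  have : IsProbabilityMeasure (P.map fun ω t => ε t ω) :=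
    Measure.isProbabilityMeasure_map hε'.aemeasurable
  -- Evaluation at a random index is jointly measurable because the index set is countable.
  have hev : Measurable fun q : ι × (ι → 𝓔) => q.2 q.1 :=
    measurable_from_prod_countable_right fun t => measurable_pi_apply t
  have hg : Measurable (Function.uncurry fun (z : 𝒵) (e : ι → 𝓔) => e (T z)) :=
    hev.comp ((hT.comp measurable_fst).prodMk measurable_snd)
  -- For each fixed `z`, evaluation at `T z` sends the joint noise law to `ν`, whatever `z` is; the
  -- skew product then has law `(P.map Z).prod ν`.
  have h := (MeasurePreserving.id (P.map Z)).skew_product (μc := P.map fun ω t => ε t ω) (μd := ν)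
    hg (Eventually.of_forall fun z => by
      rw [Measure.map_map (measurable_pi_apply _) hε']
      exact hν (T z))
  rw [← h.map_eq, ← (indepFun_iff_map_prod_eq_prod_map_map hZ.aemeasurable hε'.aemeasurable).1
    hindep, Measure.map_map h.measurable (hZ.prodMk hε')]
  rfl

end Law

/-! ### Joint law of the design and the residuals. -/

section Model

variable {Ω₀ Ω : Type*} [MeasurableSpace Ω₀] [MeasurableSpace Ω] {P : Measure Ω₀}
  [IsProbabilityMeasure P] {μ : Measure Ω} [IsProbabilityMeasure μ] {d p : ℕ} {𝒯 : Finset ℝ}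
  {D : Set (EuclideanSpace ℝ (Fin d))} {X : Ω₀ → EuclideanSpace ℝ (Fin d)} {T : Ω₀ → 𝒯}
  {Y ε : 𝒯 → Ω₀ → ℝ} {σ : ℝ≥0} {g : ℝ → EuclideanSpace ℝ (Fin d) → ℝ}
  {f : Fin p → EuclideanSpace ℝ (Fin d) → ℝ} {β : 𝒯 → EuclideanSpace ℝ (Fin p)}
  {Xs : ℕ → Ω → EuclideanSpace ℝ (Fin d)} {Ts : ℕ → Ω → 𝒯} {Ys : ℕ → Ω → ℝ}

lemma LinearOutcomeModel.map_residual_eq (hmodel : LinearOutcomeModel P 𝒯 D X T Y ε σ g f β) :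
    P.map (fun ω => ((T ω, X ω), Y (T ω) ω - predict f (β (T ω)) (X ω)))
      = (P.map fun ω => (T ω, X ω)).prod (gaussianReal 0 (σ ^ 2)) := by
  rw [← map_prod_eval_eq_prod (T := Prod.fst) (hmodel.measurable_T.prodMk hmodel.measurable_X)
    measurable_fst hmodel.measurable_noise hmodel.noise_law hmodel.noise_indep_design.symm]
  -- Almost surely the residual is the selected noise `ε (T ω) ω`.
  refine Measure.map_congr ?_
  filter_upwards [ae_all_iff.2 hmodel.outcome, hmodel.mem_domain] with ω hω hD
  simp [hω, hmodel.linear _ _ hD]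

lemma measurable_residual {𝒯' V : Type*} [MeasurableSpace 𝒯'] [Countable 𝒯']
    [MeasurableSingletonClass 𝒯'] [MeasurableSpace V] {f : Fin p → V → ℝ}
    (hf : ∀ j, Measurable (f j)) (β : 𝒯' → EuclideanSpace ℝ (Fin p)) :
    Measurable fun q : V × 𝒯' × ℝ => q.2.2 - predict f (β q.2.1) q.1 :=
  measurable_snd.snd.sub
    (measurable_predict hf ((measurable_of_countable β).comp measurable_snd.fst) measurable_fst)

/-- The residuals of a sample of size `n` are independent of the design, and they are independent
centred Gaussian with variance `σ ^ 2`. -/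
lemma IsObservedSample.map_design_residual_eq
    (hsample : IsObservedSample P μ X T Y Xs Ts Ys)
    (hmodel : LinearOutcomeModel P 𝒯 D X T Y ε σ g f β) (n : ℕ) :
    μ.map (fun ω => (((fun i : Fin n => Xs i ω), (fun i : Fin n => Ts i ω)),
        fun i : Fin n => Ys i ω - predict f (β (Ts i ω)) (Xs i ω)))
      = (μ.map fun ω => ((fun i : Fin n => Xs i ω), (fun i : Fin n => Ts i ω))).prod
          (Measure.pi fun _ : Fin n => gaussianReal 0 (σ ^ 2)) := by
  let V := EuclideanSpace ℝ (Fin d)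
  have hres := measurable_residual hmodel.measurable_basis β
  let h : V × 𝒯 × ℝ → (𝒯 × V) × ℝ :=
    fun q => ((q.2.1, q.1), q.2.2 - predict f (β q.2.1) q.1)
  have hh : Measurable h := (measurable_snd.fst.prodMk measurable_fst).prodMk hres
  have hU (i : ℕ) : Measurable fun ω => (Xs i ω, Ts i ω, Ys i ω) :=
    (hsample.measurable_Xs i).prodMk
      ((hsample.measurable_Ts i).prodMk (hsample.measurable_Ys i))
  have hlaw (i : ℕ) : μ.map (fun ω => h (Xs i ω, Ts i ω, Ys i ω))
      = (P.map fun ω => (T ω, X ω)).prod (gaussianReal 0 (σ ^ 2)) := by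
    rw [← hmodel.map_residual_eq]
    exact ((hsample.identDistrib i).comp hh).map_eq
  have : IsProbabilityMeasure (P.map fun ω => (T ω, X ω)) :=
    Measure.isProbabilityMeasure_map (hmodel.measurable_T.prodMk hmodel.measurable_X).aemeasurable
  have hind : iIndepFun (fun (i : Fin n) ω => h (Xs i ω, Ts i ω, Ys i ω)) μ :=
    (hsample.indep.precomp (Fin.val_injective (n := n))).comp (fun _ => h) fun _ => hh
  have hpi := (iIndepFun_iff_map_fun_eq_pi_map
    (f := fun (i : Fin n) ω => h (Xs i ω, Ts i ω, Ys i ω))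
    fun i => (hh.comp (hU i)).aemeasurable).1 hind
  simp only [hlaw] at hpi
  have hmeas : Measurable fun ω (i : Fin n) => h (Xs i ω, Ts i ω, Ys i ω) :=
    measurable_pi_iff.2 fun i => hh.comp (hU i)
  -- The units are i.i.d. pairs (design, residual); regrouping a product of pairs into a pair of
  -- products separates the whole design from all residuals.
  have harrow := measurePreserving_arrowProdEquivProdArrow (𝒯 × V) ℝ (Fin n)
    (fun _ => P.map fun ω => (T ω, X ω)) (fun _ => gaussianReal 0 (σ ^ 2))
  have hprod : μ.map (fun ω => ((fun i : Fin n => (Ts i ω, Xs i ω)),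
        fun i : Fin n => Ys i ω - predict f (β (Ts i ω)) (Xs i ω)))
      = (Measure.pi fun _ : Fin n => P.map fun ω => (T ω, X ω)).prod
          (Measure.pi fun _ : Fin n => gaussianReal 0 (σ ^ 2)) := by
    rw [← harrow.map_eq, ← hpi, Measure.map_map harrow.measurable hmeas]
    rfl
  have hswap : Measurable fun z : Fin n → 𝒯 × V => ((fun i => (z i).2), fun i => (z i).1) := by
    fun_prop
  exact map_comp_prod_of_map_eq_prod
    (measurable_pi_iff.2 fun i : Fin n =>
      (hsample.measurable_Ts i).prodMk (hsample.measurable_Xs i))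
    (measurable_pi_iff.2 fun i : Fin n => hres.comp (hU i)) hprod hswap

end Model

/-! ### The T-learner applied to Gaussian noise, for a fixed design. -/

section GaussianNoise

variable {V 𝒯 : Type*} [DecidableEq 𝒯] {p n : ℕ}

/-- The characteristic function of `∑ cᵢeᵢ` factors by independence, giving that of a centred
Gaussian with variance `v ∑ cᵢ²`. -/
lemma integral_exp_sum_mul_pi_gaussianReal {ι : Type*} [Fintype ι] (v : ℝ≥0) (c : ι → ℝ) :
    ∫ e, Complex.exp (((∑ i, c i * e i : ℝ) : ℂ) * Complex.I)
        ∂(Measure.pi fun _ : ι => gaussianReal 0 v)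
      = Complex.exp (-((v * ∑ i, c i ^ 2 : ℝ) : ℂ) / 2) := by
  have h (e : ι → ℝ) : Complex.exp (((∑ i, c i * e i : ℝ) : ℂ) * Complex.I)
      = ∏ i, Complex.exp (c i * e i * Complex.I) := by
    rw [← Complex.exp_sum, ← Finset.sum_mul]
    push_cast
    rfl
  simp_rw [h]
  rw [integral_fintype_prod_eq_prod (𝕜 := ℂ) (fun i (y : ℝ) => Complex.exp (c i * y * Complex.I))]
  simp_rw [← charFun_apply_real, charFun_gaussianReal]
  rw [← Complex.exp_sum]
  congr 1
  push_cast
  rw [Finset.mul_sum, ← Finset.sum_neg_distrib, Finset.sum_div]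
  exact Finset.sum_congr rfl fun i _ => by ring

lemma dotProduct_inv_mulVec_groupGram (f : Fin p → V → ℝ) (x : Fin n → V) (w : Fin n → 𝒯) (t : 𝒯)
    (h : (groupGram f x w t).det ≠ 0) (s : Fin p → ℝ) :
    ((groupGram f x w t)⁻¹ *ᵥ s) ⬝ᵥ (groupGram f x w t *ᵥ ((groupGram f x w t)⁻¹ *ᵥ s))
      = s ⬝ᵥ ((groupGram f x w t)⁻¹ *ᵥ s) := by
  rw [Matrix.mulVec_mulVec, Matrix.mul_nonsing_inv _ (isUnit_iff_ne_zero.2 h), Matrix.one_mulVec,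
    dotProduct_comm]

/-- Characteristic function of the T-learner applied to Gaussian noise, for a fixed design. -/
lemma integral_exp_dotProduct_tCoef (f : Fin p → V → ℝ) {tk t0 : 𝒯} (hk : tk ≠ t0) (x : Fin n → V)
    (w : Fin n → 𝒯) (h : FullRank f tk t0 x w) (v : ℝ≥0) (s : Fin p → ℝ) :
    ∫ e, Complex.exp (((s ⬝ᵥ (tCoef f tk t0 x w e).ofLp : ℝ) : ℂ) * Complex.I)
        ∂(Measure.pi fun _ : Fin n => gaussianReal 0 v)
      = Complex.exp (-((v * (s ⬝ᵥ (((groupGram f x w tk)⁻¹ + (groupGram f x w t0)⁻¹) *ᵥ s)) : ℝ)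
          : ℂ) / 2) := by
  have hdet := (fullRank_iff ..).1 h
  let c (t : 𝒯) (i : Fin n) : ℝ := if w i = t then
    predict f (WithLp.toLp 2 ((groupGram f x w t)⁻¹ *ᵥ s)) (x i) else 0
  have hlin (e : Fin n → ℝ) : s ⬝ᵥ (tCoef f tk t0 x w e).ofLp
      = ∑ i, (c tk i - c t0 i) * e i := by
    rw [tCoef, WithLp.ofLp_sub, dotProduct_sub, dotProduct_groupOLS, dotProduct_groupOLS,
      ← Finset.sum_sub_distrib]
    exact Finset.sum_congr rfl fun i _ => by ring
  have hsq : ∑ i, (c tk i - c t0 i) ^ 2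
      = s ⬝ᵥ (((groupGram f x w tk)⁻¹ + (groupGram f x w t0)⁻¹) *ᵥ s) := by
    rw [Matrix.add_mulVec, dotProduct_add, ← dotProduct_inv_mulVec_groupGram f x w tk hdet.1,
      ← dotProduct_inv_mulVec_groupGram f x w t0 hdet.2]
    have hp (t : 𝒯) := sum_ite_predict_sq f x w t (WithLp.toLp 2 ((groupGram f x w t)⁻¹ *ᵥ s))
    rw [← hp, ← hp, ← Finset.sum_add_distrib]
    -- The cross terms `c tk i * c t0 i` vanish since a unit belongs to at most one of the two
    -- groups; here `tk ≠ t0` matters.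
    refine Finset.sum_congr rfl fun i _ => ?_
    by_cases h1 : w i = tk
    · have h2 : w i ≠ t0 := fun h2 => hk (h1.symm.trans h2)
      simp [c, h1, hk]
    · by_cases h2 : w i = t0
      · simp [c, h2, hk.symm]
      · simp [c, h1, h2]
  simp_rw [hlin]
  rw [integral_exp_sum_mul_pi_gaussianReal, hsq]

/-- For a fixed design the coefficients are a linear map of the noise, which is integrable with mean
zero. Singular designs are included. -/
lemma integrable_groupOLS_and_integral_eq_zero (f : Fin p → V → ℝ) (x : Fin n → V)
    (w : Fin n → 𝒯) (t : 𝒯) (v : ℝ≥0) :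
    Integrable (fun e => groupOLS f x w e t) (Measure.pi fun _ : Fin n => gaussianReal 0 v) ∧
      ∫ e, groupOLS f x w e t ∂(Measure.pi fun _ : Fin n => gaussianReal 0 v) = 0 := by
  let L : (Fin n → ℝ) →ₗ[ℝ] EuclideanSpace ℝ (Fin p) :=
    (WithLp.linearEquiv 2 ℝ (Fin p → ℝ)).symm.toLinearMap ∘ₗ
      (((groupGram f x w t)⁻¹).mulVecLin ∘ₗ
        (Matrix.of fun j i => if w i = t then f j (x i) else 0).mulVecLin)
  have hL (e : Fin n → ℝ) : groupOLS f x w e t = L.toContinuousLinearMap e := by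
    rw [groupOLS_eq]
    have : groupMoment f x w e t
        = (Matrix.of fun j i => if w i = t then f j (x i) else 0) *ᵥ e := by
      ext j
      simp only [groupMoment, Matrix.mulVec, dotProduct, Matrix.of_apply, ite_mul, zero_mul]
    rw [this]
    rfl
  have hid : Integrable (fun e : Fin n → ℝ => e) (Measure.pi fun _ : Fin n => gaussianReal 0 v) :=
    Integrable.of_eval fun i => integrable_eval IsGaussian.integrable_id
  simp_rw [hL]
  refine ⟨L.toContinuousLinearMap.integrable_comp hid, ?_⟩
  rw [L.toContinuousLinearMap.integral_comp_comm hid]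
  have h0 : ∫ e, e ∂(Measure.pi fun _ : Fin n => gaussianReal 0 v) = 0 := by
    ext i
    rw [eval_integral fun i => integrable_eval IsGaussian.integrable_id, integral_eval,
      integral_id_gaussianReal]
    rfl
  rw [h0, map_zero]

lemma integrable_tCoef_and_integral_eq_zero (f : Fin p → V → ℝ) (tk t0 : 𝒯) (x : Fin n → V)
    (w : Fin n → 𝒯) (v : ℝ≥0) :
    Integrable (fun e => tCoef f tk t0 x w e) (Measure.pi fun _ : Fin n => gaussianReal 0 v) ∧
      ∫ e, tCoef f tk t0 x w e ∂(Measure.pi fun _ : Fin n => gaussianReal 0 v) = 0 := by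
  have h (t : 𝒯) := integrable_groupOLS_and_integral_eq_zero f x w t v
  refine ⟨(h tk).1.sub (h t0).1, ?_⟩
  simp_rw [tCoef]
  rw [integral_sub (h tk).1 (h t0).1, (h tk).2, (h t0).2, sub_zero]

end GaussianNoise

/-! ### From conditional characteristic functions to asymptotic normality. -/

/-- The characteristic function is the mean of the conditional one, which is bounded by one, so its
almost sure convergence to a constant passes to the mean. The representation of `b n` is needed only
for large `n`, as the design may be singular before. -/
lemma isAsymptoticallyNormal_of_tendsto_conditional_charFun {Ω : Type*} [MeasurableSpace Ω] {p : ℕ}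
    {𝒵 𝓔 : ℕ → Type*} [∀ n, MeasurableSpace (𝒵 n)] [∀ n, MeasurableSpace (𝓔 n)] {μ : Measure Ω}
    [IsProbabilityMeasure μ] {ν : ∀ n, Measure (𝓔 n)} [∀ n, IsProbabilityMeasure (ν n)]
    {Z : ∀ n, Ω → 𝒵 n} {E : ∀ n, Ω → 𝓔 n} {φ : ∀ n, 𝒵 n × 𝓔 n → EuclideanSpace ℝ (Fin p)}
    {b : ℕ → Ω → EuclideanSpace ℝ (Fin p)} {β : EuclideanSpace ℝ (Fin p)}
    {C : Matrix (Fin p) (Fin p) ℝ} (hC : C.PosSemidef)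
    (hZ : ∀ n, Measurable (Z n)) (hE : ∀ n, Measurable (E n)) (hb : ∀ n, Measurable (b n))
    (hφ : ∀ n, Measurable (φ n))
    (hlaw : ∀ n, μ.map (fun ω => (Z n ω, E n ω)) = (μ.map (Z n)).prod (ν n))
    (hbφ : ∀ᵐ ω ∂μ, ∀ᶠ n in atTop, b n ω = β + φ n (Z n ω, E n ω))
    (hchar : ∀ s : EuclideanSpace ℝ (Fin p), ∀ᵐ ω ∂μ, Tendsto
      (fun n : ℕ => ∫ e, Complex.exp ((inner ℝ (φ n (Z n ω, e)) (√(n : ℝ) • s) : ℝ) * Complex.I)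
        ∂(ν n)) atTop (𝓝 (Complex.exp (-((s.ofLp ⬝ᵥ (C *ᵥ s.ofLp) : ℝ) : ℂ) / 2)))) :
    IsAsymptoticallyNormal μ b β C := by
  have hmeas (n : ℕ) : Measurable fun ω => √(n : ℝ) • (b n ω - β) :=
    ((hb n).sub_const β).const_smul (√(n : ℝ))
  refine ⟨hC, fun n => (hmeas n).aemeasurable, aemeasurable_id, ?_⟩
  refine ProbabilityMeasure.tendsto_iff_tendsto_charFun.2 fun s => ?_
  change Tendsto (fun n : ℕ => charFun (μ.map fun ω => √(n : ℝ) • (b n ω - β)) s) atTop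
    (𝓝 (charFun ((multivariateGaussian 0 C).map id) s))
  rw [Measure.map_id, charFun_multivariateGaussian hC]
  let k (n : ℕ) (v : EuclideanSpace ℝ (Fin p)) : ℂ :=
    Complex.exp ((inner ℝ v (√(n : ℝ) • s) : ℝ) * Complex.I)
  have hk (n : ℕ) : Continuous (k n) := by fun_prop
  have hk1 (n : ℕ) (v) : ‖k n v‖ = 1 := Complex.norm_exp_ofReal_mul_I _
  have hchar' : ∀ n : ℕ, charFun (μ.map fun ω => √(n : ℝ) • (b n ω - β)) s
      = ∫ ω, k n (b n ω - β) ∂μ := by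
    intro n
    rw [charFun_apply, integral_map (hmeas n).aemeasurable
      (by fun_prop : Continuous fun x : EuclideanSpace ℝ (Fin p) =>
        Complex.exp ((inner ℝ x s : ℝ) * Complex.I)).aestronglyMeasurable]
    simp only [k, inner_smul_left, inner_smul_right, conj_trivial]
  simp only [hchar']
  have hkb (n : ℕ) : AEStronglyMeasurable (fun ω => k n (b n ω - β)) μ :=
    ((hk n).measurable.comp ((hb n).sub_const β)).aestronglyMeasurable
  have hkφ (n : ℕ) : Measurable fun q => k n (φ n q) := (hk n).measurable.comp (hφ n)
  have hkφ' (n : ℕ) : AEStronglyMeasurable (fun ω => k n (φ n (Z n ω, E n ω))) μ :=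
    ((hkφ n).comp ((hZ n).prodMk (hE n))).aestronglyMeasurable
  have hint₁ (n : ℕ) : Integrable (fun ω => k n (b n ω - β)) μ :=
    Integrable.of_bound (hkb n) 1 (ae_of_all _ fun ω => (hk1 n _).le)
  have hint₂ (n : ℕ) : Integrable (fun ω => k n (φ n (Z n ω, E n ω))) μ :=
    Integrable.of_bound (hkφ' n) 1 (ae_of_all _ fun ω => (hk1 n _).le)
  -- Replacing `b n - β` by `φ n` costs nothing in the limit: the integrand is bounded by `2` and
  -- almost surely eventually zero.
  have hdiff : Tendsto (fun n => ∫ ω, (k n (b n ω - β) - k n (φ n (Z n ω, E n ω))) ∂μ) atTop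
      (𝓝 0) := by
    rw [← integral_zero Ω ℂ (μ := μ)]
    refine tendsto_integral_of_dominated_convergence (fun _ => 2)
      (fun n => (hkb n).sub (hkφ' n)) (integrable_const _) (fun n => ae_of_all _ fun ω => ?_) ?_
    · exact (norm_sub_le _ _).trans (by rw [hk1, hk1]; norm_num)
    · filter_upwards [hbφ] with ω hω
      refine tendsto_const_nhds.congr' ?_
      filter_upwards [hω] with n hn
      rw [hn, add_sub_cancel_left, sub_self]
  have hcond (n : ℕ) : ∫ ω, k n (φ n (Z n ω, E n ω)) ∂μ
      = ∫ ω, ∫ e, k n (φ n (Z n ω, e)) ∂(ν n) ∂μ := by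
    have : IsProbabilityMeasure (μ.map (Z n)) :=
      Measure.isProbabilityMeasure_map (hZ n).aemeasurable
    have hsm : StronglyMeasurable fun z => ∫ e, k n (φ n (z, e)) ∂(ν n) :=
      (hkφ n).stronglyMeasurable.integral_prod_right'
    rw [← integral_map (hZ n).aemeasurable hsm.aestronglyMeasurable,
      ← integral_prod (fun q => k n (φ n q))
        (Integrable.of_bound (hkφ n).aestronglyMeasurable 1 (ae_of_all _ fun q => (hk1 n _).le)),
      ← hlaw n, integral_map ((hZ n).prodMk (hE n)).aemeasurable (hkφ n).aestronglyMeasurable]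
  have hmain : Tendsto (fun n => ∫ ω, k n (φ n (Z n ω, E n ω)) ∂μ) atTop
      (𝓝 (Complex.exp (-((s.ofLp ⬝ᵥ (C *ᵥ s.ofLp) : ℝ) : ℂ) / 2))) := by
    simp only [hcond]
    have hconst : ∫ _ : Ω, Complex.exp (-((s.ofLp ⬝ᵥ (C *ᵥ s.ofLp) : ℝ) : ℂ) / 2) ∂μ
        = Complex.exp (-((s.ofLp ⬝ᵥ (C *ᵥ s.ofLp) : ℝ) : ℂ) / 2) := by simp
    rw [← hconst]
    refine tendsto_integral_of_dominated_convergence (fun _ => 1)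
      (fun n => ?_) (integrable_const _) (fun n => ae_of_all _ fun ω => ?_) (hchar s)
    · exact ((hkφ n).stronglyMeasurable.integral_prod_right'.comp_measurable
        (hZ n)).aestronglyMeasurable
    · refine (norm_integral_le_of_norm_le_const (ae_of_all _ fun e => (hk1 n _).le)).trans ?_
      simp
  have hsum := hdiff.add hmain
  simp only [integral_sub (hint₁ _) (hint₂ _), sub_add_cancel, zero_add] at hsum
  convert hsum using 2
  rw [inner_zero_right]
  congr 1
  push_cast
  ring

/-! ### Limits of inverses of normalised matrices. -/

section MatrixLimits

variable {p : ℕ}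

lemma tendsto_nonsing_inv {A : ℕ → Matrix (Fin p) (Fin p) ℝ} {M : Matrix (Fin p) (Fin p) ℝ}
    (h : Tendsto A atTop (𝓝 M)) (hM : M.det ≠ 0) : Tendsto (fun n => (A n)⁻¹) atTop (𝓝 M⁻¹) := by
  simp only [Matrix.inv_def, Ring.inverse_eq_inv']
  have hdet : Tendsto (fun n => (A n).det) atTop (𝓝 M.det) :=
    (continuous_id.matrix_det.tendsto M).comp h
  have hadj : Tendsto (fun n => (A n).adjugate) atTop (𝓝 M.adjugate) :=
    (continuous_id.matrix_adjugate.tendsto M).comp h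
  exact (hdet.inv₀ hM).smul hadj

lemma nonsing_inv_smul {c : ℝ} (hc : c ≠ 0) {A : Matrix (Fin p) (Fin p) ℝ} (hA : A.det ≠ 0) :
    (c • A)⁻¹ = c⁻¹ • A⁻¹ := by
  have := invertibleOfNonzero hc
  rw [Matrix.inv_smul _ _ (isUnit_iff_ne_zero.2 hA), invOf_eq_inv]

lemma eventually_det_ne_zero {A : ℕ → Matrix (Fin p) (Fin p) ℝ} {M : Matrix (Fin p) (Fin p) ℝ}
    (h : Tendsto (fun n : ℕ => (n : ℝ)⁻¹ • A n) atTop (𝓝 M)) (hM : M.det ≠ 0) :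
    ∀ᶠ n in atTop, (A n).det ≠ 0 := by
  have hdet := ((continuous_id.matrix_det.tendsto M).comp h).eventually_ne hM
  filter_upwards [hdet] with n hn h0
  simp only [Function.comp_apply, id_eq, Matrix.det_smul, h0, mul_zero] at hn
  exact hn rfl

lemma tendsto_smul_inv {A : ℕ → Matrix (Fin p) (Fin p) ℝ} {M : Matrix (Fin p) (Fin p) ℝ}
    (h : Tendsto (fun n : ℕ => (n : ℝ)⁻¹ • A n) atTop (𝓝 M)) (hM : M.det ≠ 0) :
    Tendsto (fun n : ℕ => (n : ℝ) • (A n)⁻¹) atTop (𝓝 M⁻¹) := by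
  refine (tendsto_nonsing_inv h hM).congr' ?_
  filter_upwards [eventually_det_ne_zero h hM, eventually_ne_atTop 0] with n hn h0
  rw [nonsing_inv_smul (inv_ne_zero (Nat.cast_ne_zero.2 h0)) hn, inv_inv]

end MatrixLimits

/-! ### Gram matrices as quadratic forms. -/

section Gram

variable {Ω₀ V : Type*} [MeasurableSpace Ω₀] {p : ℕ}

lemma dotProduct_gram_mulVec {P : Measure Ω₀} {X : Ω₀ → V} {f : Fin p → V → ℝ}
    (hint : ∀ i j, Integrable (fun ω => f i (X ω) * f j (X ω)) P)
    (v : EuclideanSpace ℝ (Fin p)) :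
    v.ofLp ⬝ᵥ (gram P X f *ᵥ v.ofLp) = ∫ ω, predict f v (X ω) ^ 2 ∂P := by
  have h (ω : Ω₀) : predict f v (X ω) ^ 2
      = ∑ i, ∑ j, v i * v j * (f i (X ω) * f j (X ω)) := by
    rw [sq, predict, Finset.sum_mul_sum]
    exact Finset.sum_congr rfl fun i _ => Finset.sum_congr rfl fun j _ => by ring
  simp_rw [h]
  rw [integral_finsetSum _ fun i _ => integrable_finsetSum _ fun j _ =>
    (hint i j).const_mul (v i * v j)]
  simp only [dotProduct, Matrix.mulVec, gram, Matrix.of_apply, Finset.mul_sum]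
  refine Finset.sum_congr rfl fun i _ => ?_
  rw [integral_finsetSum _ fun j _ => (hint i j).const_mul (v i * v j)]
  refine Finset.sum_congr rfl fun j _ => ?_
  rw [integral_const_mul]
  ring

lemma isHermitian_gram (P : Measure Ω₀) (X : Ω₀ → V) (f : Fin p → V → ℝ) :
    (gram P X f).IsHermitian := by
  ext i j
  simp [gram, mul_comm]

lemma posSemidef_gram {P : Measure Ω₀} {X : Ω₀ → V} {f : Fin p → V → ℝ}
    (hint : ∀ i j, Integrable (fun ω => f i (X ω) * f j (X ω)) P) : (gram P X f).PosSemidef := by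
  refine .of_dotProduct_mulVec_nonneg (isHermitian_gram P X f) fun v => ?_
  have h := dotProduct_gram_mulVec hint (WithLp.toLp 2 v)
  rw [star_trivial]
  exact h.symm ▸ integral_nonneg fun ω => sq_nonneg _

/-- Conditioning is restriction normalised by `ρ(t)`. The unnormalised matrix is the one that the
strong law and overlap deal with. -/
lemma condGram_eq_smul {𝒯 : Type*} (P : Measure Ω₀) (X : Ω₀ → V) (T : Ω₀ → 𝒯)
    (f : Fin p → V → ℝ) (t : 𝒯) :
    condGram P X T f t = (rho P T t)⁻¹ • gram (P.restrict (T ⁻¹' {t})) X f := by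
  ext i j
  simp only [condGram, gram, Matrix.of_apply, Matrix.smul_apply, ProbabilityTheory.cond,
    integral_smul_measure, rho, measureReal_def, ENNReal.toReal_inv]

end Gram

/-! ### Entrywise bounds for inverses of positive definite matrices. -/

section CovarianceBound

variable {p : ℕ}

/-- Nonnegativity of the form at `e_i ± e_j` gives `2|A i j| ≤ A i i + A j j`, and the diagonal
entries are at most `m`. -/
lemma abs_apply_le_of_dotProduct_le {A : Matrix (Fin p) (Fin p) ℝ} (hA : A.PosSemidef) {m : ℝ}
    (hm : ∀ v : Fin p → ℝ, v ⬝ᵥ (A *ᵥ v) ≤ m * (v ⬝ᵥ v)) (i j : Fin p) : |A i j| ≤ m := by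
  have hsymm : A j i = A i j := by simpa using hA.1.apply i j
  have hpos (v : Fin p → ℝ) : 0 ≤ v ⬝ᵥ (A *ᵥ v) := by
    simpa using hA.dotProduct_mulVec_nonneg v
  have hentry (a b : ℝ) : (a • Pi.single i 1 + b • Pi.single j 1 : Fin p → ℝ) ⬝ᵥ
      (A *ᵥ (a • Pi.single i 1 + b • Pi.single j 1))
      = a ^ 2 * A i i + 2 * a * b * A i j + b ^ 2 * A j j := by
    simp only [Matrix.mulVec_add, Matrix.mulVec_smul, Matrix.mulVec_single_one, add_dotProduct,
      dotProduct_add, smul_dotProduct, dotProduct_smul, single_one_dotProduct, Matrix.col_apply,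
      smul_eq_mul, hsymm]
    ring
  have hdiag (k : Fin p) : A k k ≤ m := by
    simpa using hm (Pi.single k 1)
  have h₁ := hentry 1 1 ▸ hpos _
  have h₂ := hentry 1 (-1) ▸ hpos _
  have hi := hdiag i
  have hj := hdiag j
  rw [abs_le]
  constructor <;> linarith

lemma abs_inv_apply_le {F : Matrix (Fin p) (Fin p) ℝ} (hF : F.PosDef) {c : ℝ} (hc : 0 < c)
    (h : (F - c • 1).PosSemidef) (i j : Fin p) : |F⁻¹ i j| ≤ c⁻¹ := by
  refine abs_apply_le_of_dotProduct_le hF.inv.posSemidef (fun v => ?_) i j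
  have hdet : IsUnit F.det := isUnit_iff_ne_zero.2 hF.det_pos.ne'
  let u := F⁻¹ *ᵥ v
  have hFu : F *ᵥ u = v := by
    rw [Matrix.mulVec_mulVec, Matrix.mul_nonsing_inv _ hdet, Matrix.one_mulVec]
  have h₁ : c * (u ⬝ᵥ u) ≤ u ⬝ᵥ v := by
    have := h.dotProduct_mulVec_nonneg u
    rw [star_trivial, Matrix.sub_mulVec, hFu, dotProduct_sub, Matrix.smul_mulVec,
      Matrix.one_mulVec, dotProduct_smul, smul_eq_mul] at this
    linarith
  -- Expanding this square and using `c‖u‖² ≤ u·v` leaves `0 ≤ ‖v‖² - c (u·v)`, the required bound.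
  have h₂ : 0 ≤ (v - c • u) ⬝ᵥ (v - c • u) :=
    Finset.sum_nonneg fun k _ => mul_self_nonneg _
  have h₃ : (v - c • u) ⬝ᵥ (v - c • u) = v ⬝ᵥ v - 2 * c * (u ⬝ᵥ v) + c ^ 2 * (u ⬝ᵥ u) := by
    simp only [dotProduct_sub, sub_dotProduct, dotProduct_smul, smul_dotProduct, smul_eq_mul,
      dotProduct_comm v u]
    ring
  change v ⬝ᵥ u ≤ c⁻¹ * (v ⬝ᵥ v)
  rw [dotProduct_comm v u, inv_mul_eq_div, le_div_iff₀ hc]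
  nlinarith

end CovarianceBound

/-! ### Consequences of overlap, and the CATE. -/

section Population

variable {Ω₀ : Type*} [MeasurableSpace Ω₀] {P : Measure Ω₀}
  [IsProbabilityMeasure P] {d p : ℕ} {𝒯 : Finset ℝ}
  {D : Set (EuclideanSpace ℝ (Fin d))} {X : Ω₀ → EuclideanSpace ℝ (Fin d)} {T : Ω₀ → 𝒯}
  {Y ε : 𝒯 → Ω₀ → ℝ} {σ : ℝ≥0} {g : ℝ → EuclideanSpace ℝ (Fin d) → ℝ}
  {f : Fin p → EuclideanSpace ℝ (Fin d) → ℝ} {β : 𝒯 → EuclideanSpace ℝ (Fin p)}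

namespace LinearOutcomeModel

lemma integrable_basis_mul (hmodel : LinearOutcomeModel P 𝒯 D X T Y ε σ g f β) (i j : Fin p) :
    Integrable (fun ω => f i (X ω) * f j (X ω)) P := by
  obtain ⟨B, hB⟩ := hmodel.bounded_basis
  have hm (k : Fin p) : Measurable fun ω => f k (X ω) :=
    (hmodel.measurable_basis k).comp hmodel.measurable_X
  refine Integrable.of_bound ((hm i).mul (hm j)).aestronglyMeasurable (B * B) ?_
  filter_upwards [hmodel.mem_domain] with ω hω
  rw [norm_mul]
  exact mul_le_mul (hB i _ hω) (hB j _ hω) (norm_nonneg _) ((abs_nonneg _).trans (hB i _ hω))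

lemma integrable_predict (hmodel : LinearOutcomeModel P 𝒯 D X T Y ε σ g f β)
    (b : EuclideanSpace ℝ (Fin p)) : Integrable (fun ω => predict f b (X ω)) P := by
  obtain ⟨B, hB⟩ := hmodel.bounded_basis
  refine integrable_finsetSum _ fun j _ => Integrable.mul_const ?_ _
  refine Integrable.of_bound
    ((hmodel.measurable_basis j).comp hmodel.measurable_X).aestronglyMeasurable B ?_
  filter_upwards [hmodel.mem_domain] with ω hω using hB j _ hω

lemma integrable_predict_sq (hmodel : LinearOutcomeModel P 𝒯 D X T Y ε σ g f β)
    (b : EuclideanSpace ℝ (Fin p)) : Integrable (fun ω => predict f b (X ω) ^ 2) P := by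
  simp only [sq, predict, Finset.sum_mul_sum]
  refine integrable_finsetSum _ fun i _ => integrable_finsetSum _ fun j _ => ?_
  refine ((hmodel.integrable_basis_mul i j).const_mul (b i * b j)).congr ?_
  exact ae_of_all _ fun ω => by ring

/-- Overlap, in integrated form. -/
lemma exists_mul_integral_le_setIntegral (hmodel : LinearOutcomeModel P 𝒯 D X T Y ε σ g f β) :
    ∃ r : ℝ, 0 < r ∧ ∀ t, ∀ h : EuclideanSpace ℝ (Fin d) → ℝ, Measurable h → (∀ x, 0 ≤ h x) →
      Integrable (fun ω => h (X ω)) P →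
        r * ∫ ω, h (X ω) ∂P ≤ ∫ ω in T ⁻¹' {t}, h (X ω) ∂P := by
  obtain ⟨r, hr, hoverlap⟩ := hmodel.overlap
  refine ⟨r, hr, fun t h hh h0 hint => ?_⟩
  have hle := hmodel.measurable_X.comap_le
  have hT : MeasurableSet (T ⁻¹' {t}) := hmodel.measurable_T (measurableSet_singleton t)
  have hX : StronglyMeasurable[MeasurableSpace.comap X inferInstance] fun ω => h (X ω) :=
    (hh.comp (comap_measurable X)).stronglyMeasurable
  have hind : Integrable ((T ⁻¹' {t}).indicator fun _ => (1 : ℝ)) P :=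
    (integrable_const _).indicator hT
  have heq (ω : Ω₀) : h (X ω) * (T ⁻¹' {t}).indicator (fun _ => (1 : ℝ)) ω
      = (T ⁻¹' {t}).indicator (fun ω => h (X ω)) ω := by
    by_cases hω : ω ∈ T ⁻¹' {t} <;> simp [hω]
  have hmul : Integrable
      ((fun ω => h (X ω)) * (T ⁻¹' {t}).indicator fun _ => (1 : ℝ)) P := by
    refine (hint.indicator hT).congr (ae_of_all _ fun ω => (heq ω).symm)
  -- `h(X)` leaves the conditional expectation, and the remaining factor is the propensity score,
  -- bounded below by `r`.
  have hpull := condExp_mul_of_stronglyMeasurable_left hX hmul hind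
  calc r * ∫ ω, h (X ω) ∂P = ∫ ω, h (X ω) * r ∂P := by rw [integral_mul_const, mul_comm]
    _ ≤ ∫ ω, (P[(fun ω => h (X ω)) * (T ⁻¹' {t}).indicator (fun _ => (1 : ℝ)) |
          MeasurableSpace.comap X inferInstance]) ω ∂P := by
        refine integral_mono_ae (hint.mul_const r) integrable_condExp ?_
        filter_upwards [hpull, hoverlap t] with ω h₁ h₂
        rw [h₁]
        exact mul_le_mul_of_nonneg_left h₂ (h0 _)
    _ = ∫ ω in T ⁻¹' {t}, h (X ω) ∂P := by
        rw [integral_condExp hle, ← integral_indicator hT]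
        exact integral_congr_ae (ae_of_all _ heq)

lemma rho_pos (hmodel : LinearOutcomeModel P 𝒯 D X T Y ε σ g f β) (t : 𝒯) : 0 < rho P T t := by
  obtain ⟨r, hr, h⟩ := hmodel.exists_mul_integral_le_setIntegral
  have := h t (fun _ => 1) measurable_const (fun _ => zero_le_one) (integrable_const _)
  simp only [integral_const, smul_eq_mul, mul_one, probReal_univ, measureReal_restrict_apply_univ]
    at this
  exact hr.trans_le this

/-- Integrated overlap with `h = (fᵀv)²` bounds the group's quadratic form below by `r` times that
of the full Gram matrix, which is invertible and positive semidefinite, hence positive definite. -/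
lemma posDef_gram_restrict (hmodel : LinearOutcomeModel P 𝒯 D X T Y ε σ g f β)
    (hgram : IsUnit (gram P X f)) (t : 𝒯) : (gram (P.restrict (T ⁻¹' {t})) X f).PosDef := by
  obtain ⟨r, hr, h⟩ := hmodel.exists_mul_integral_le_setIntegral
  have hpos : (gram P X f).PosDef :=
    (posSemidef_gram hmodel.integrable_basis_mul).posDef_iff_isUnit.2 hgram
  refine .of_dotProduct_mulVec_pos (isHermitian_gram _ X f) fun v hv => ?_
  have h₁ := h t (fun x => predict f (WithLp.toLp 2 v) x ^ 2)
    ((measurable_predict hmodel.measurable_basis measurable_const measurable_id).pow_const 2)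
    (fun _ => sq_nonneg _) (hmodel.integrable_predict_sq _)
  rw [← dotProduct_gram_mulVec hmodel.integrable_basis_mul,
    ← dotProduct_gram_mulVec fun i j => (hmodel.integrable_basis_mul i j).restrict] at h₁
  have h₂ := hpos.dotProduct_mulVec_pos hv
  rw [star_trivial] at h₂ ⊢
  exact (mul_pos hr h₂).trans_le h₁

lemma posDef_condGram (hmodel : LinearOutcomeModel P 𝒯 D X T Y ε σ g f β)
    (hgram : IsUnit (gram P X f)) (t : 𝒯) : (condGram P X T f t).PosDef := by
  rw [condGram_eq_smul]
  exact (hmodel.posDef_gram_restrict hgram t).smul (inv_pos.2 (hmodel.rho_pos t))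

/-- The factors `ρ(t)` cancel, which puts `C` in the form produced by the strong law. -/
lemma asymptoticCov_eq (hmodel : LinearOutcomeModel P 𝒯 D X T Y ε σ g f β)
    (hgram : IsUnit (gram P X f)) (tk t0 : 𝒯) :
    asymptoticCov P X T f σ tk t0 = (σ : ℝ) ^ 2 • ((gram (P.restrict (T ⁻¹' {tk})) X f)⁻¹ +
      (gram (P.restrict (T ⁻¹' {t0})) X f)⁻¹) := by
  have h (t : 𝒯) : ((σ : ℝ) ^ 2 / rho P T t) • (condGram P X T f t)⁻¹
      = (σ : ℝ) ^ 2 • (gram (P.restrict (T ⁻¹' {t})) X f)⁻¹ := by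
    have hρ := (hmodel.rho_pos t).ne'
    rw [condGram_eq_smul, nonsing_inv_smul (inv_ne_zero hρ)
      (hmodel.posDef_gram_restrict hgram t).det_pos.ne', smul_smul, inv_inv, div_mul_cancel₀ _ hρ]
  rw [asymptoticCov, h, h, smul_add]

lemma posSemidef_asymptoticCov (hmodel : LinearOutcomeModel P 𝒯 D X T Y ε σ g f β)
    (hgram : IsUnit (gram P X f)) (tk t0 : 𝒯) :
    (asymptoticCov P X T f σ tk t0).PosSemidef := by
  rw [hmodel.asymptoticCov_eq hgram]
  have h (t : 𝒯) := (hmodel.posDef_gram_restrict hgram t).inv.posSemidef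
  exact ((h tk).add (h t0)).smul (sq_nonneg (σ : ℝ))

lemma abs_asymptoticCov_apply_le (hmodel : LinearOutcomeModel P 𝒯 D X T Y ε σ g f β)
    (hgram : IsUnit (gram P X f)) (tk t0 : 𝒯) {c : ℝ} (hc : 0 < c)
    (hck : (condGram P X T f tk - c • 1).PosSemidef)
    (hc0 : (condGram P X T f t0 - c • 1).PosSemidef) (i j : Fin p) :
    |asymptoticCov P X T f σ tk t0 i j|
      ≤ (σ : ℝ) ^ 2 / c * (1 / rho P T tk + 1 / rho P T t0) := by
  have h (t : 𝒯) (hct : (condGram P X T f t - c • 1).PosSemidef) :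
      |(σ : ℝ) ^ 2 / rho P T t * (condGram P X T f t)⁻¹ i j|
        ≤ (σ : ℝ) ^ 2 / rho P T t * c⁻¹ := by
    have hnn : 0 ≤ (σ : ℝ) ^ 2 / rho P T t := div_nonneg (sq_nonneg _) (hmodel.rho_pos t).le
    rw [abs_mul, abs_of_nonneg hnn]
    exact mul_le_mul_of_nonneg_left (abs_inv_apply_le (hmodel.posDef_condGram hgram t) hc hct i j)
      hnn
  rw [asymptoticCov, Matrix.add_apply, Matrix.smul_apply, Matrix.smul_apply, smul_eq_mul,
    smul_eq_mul]
  refine (abs_add_le _ _).trans ((add_le_add (h tk hck) (h t0 hc0)).trans_eq ?_)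
  ring

/-- The conditional average treatment effect is linear with coefficients `β tk - β t0`. -/
lemma condExp_sub_ae_eq_predict (hmodel : LinearOutcomeModel P 𝒯 D X T Y ε σ g f β) (tk t0 : 𝒯) :
    P[fun ω => Y tk ω - Y t0 ω | MeasurableSpace.comap X inferInstance]
      =ᵐ[P] fun ω => predict f (β tk - β t0) (X ω) := by
  have hle := hmodel.measurable_X.comap_le
  have hY : (fun ω => Y tk ω - Y t0 ω)
      =ᵐ[P] (fun ω => predict f (β tk - β t0) (X ω)) + fun ω => ε tk ω - ε t0 ω := by
    filter_upwards [hmodel.outcome tk, hmodel.outcome t0, hmodel.mem_domain] with ω h₁ h₂ hD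
    rw [Pi.add_apply, h₁, h₂, hmodel.linear _ _ hD, hmodel.linear _ _ hD, predict_sub]
    ring
  have hε (t : 𝒯) : Integrable (ε t) P ∧ ∫ ω, ε t ω ∂P = 0 := by
    have hm := (hmodel.measurable_noise t).aemeasurable (μ := P)
    have hi : Integrable id (P.map (ε t)) := by
      rw [hmodel.noise_law t]
      exact IsGaussian.integrable_id
    refine ⟨(integrable_map_measure aestronglyMeasurable_id hm).1 hi, ?_⟩
    rw [← integral_id_gaussianReal (μ := 0) (v := σ ^ 2), ← hmodel.noise_law t]
    exact (integral_map hm aestronglyMeasurable_id).symm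
  have hpm : Measurable fun x => predict f (β tk - β t0) x :=
    measurable_predict hmodel.measurable_basis measurable_const measurable_id
  have hp : P[fun ω => predict f (β tk - β t0) (X ω) | MeasurableSpace.comap X inferInstance]
      = fun ω => predict f (β tk - β t0) (X ω) :=
    condExp_of_stronglyMeasurable hle (hpm.comp (comap_measurable X)).stronglyMeasurable
      (hmodel.integrable_predict _)
  have hdiff : Measurable fun e : 𝒯 → ℝ => e tk - e t0 :=
    (measurable_pi_apply tk).sub (measurable_pi_apply t0)
  have hindep : IndepFun (fun ω => ε tk ω - ε t0 ω) X P :=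
    hmodel.noise_indep_design.comp hdiff measurable_snd
  -- The noise difference is independent of `X`, so its conditional expectation is its mean, zero.
  have hnoise : P[fun ω => ε tk ω - ε t0 ω | MeasurableSpace.comap X inferInstance]
      =ᵐ[P] fun _ => 0 := by
    have h := condExp_indep_eq (μ := P) (f := fun ω => ε tk ω - ε t0 ω)
      ((hmodel.measurable_noise tk).sub (hmodel.measurable_noise t0)).comap_le hle
      (comap_measurable _).stronglyMeasurable hindep
    rwa [integral_sub (hε tk).1 (hε t0).1, (hε tk).2, (hε t0).2, sub_zero] at h
  have hsum := condExp_add (hmodel.integrable_predict (β tk - β t0))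
    (g := fun ω => ε tk ω - ε t0 ω) ((hε tk).1.sub (hε t0).1)
    (MeasurableSpace.comap X inferInstance)
  filter_upwards [condExp_congr_ae hY, hnoise, hsum] with ω h₁ h₂ h₃
  rw [h₁, h₃, Pi.add_apply, hp]
  exact (congrArg _ h₂).trans (add_zero _)

end LinearOutcomeModel

end Population

/-! ### Strong law, unbiasedness and asymptotic normality for the sample. -/

section Sample

variable {Ω₀ Ω : Type*} [MeasurableSpace Ω₀] [MeasurableSpace Ω] {P : Measure Ω₀}
  {μ : Measure Ω} {d p : ℕ} {𝒯 : Finset ℝ}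
  {D : Set (EuclideanSpace ℝ (Fin d))} {X : Ω₀ → EuclideanSpace ℝ (Fin d)} {T : Ω₀ → 𝒯}
  {Y ε : 𝒯 → Ω₀ → ℝ} {σ : ℝ≥0} {g : ℝ → EuclideanSpace ℝ (Fin d) → ℝ}
  {f : Fin p → EuclideanSpace ℝ (Fin d) → ℝ} {β : 𝒯 → EuclideanSpace ℝ (Fin p)}
  {Xs : ℕ → Ω → EuclideanSpace ℝ (Fin d)} {Ts : ℕ → Ω → 𝒯} {Ys : ℕ → Ω → ℝ}

namespace IsObservedSample

lemma measurable_design (hsample : IsObservedSample P μ X T Y Xs Ts Ys) (n : ℕ) :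
    Measurable fun ω => ((fun i : Fin n => Xs i ω), (fun i : Fin n => Ts i ω)) :=
  (measurable_pi_iff.2 fun i : Fin n => hsample.measurable_Xs i).prodMk
    (measurable_pi_iff.2 fun i : Fin n => hsample.measurable_Ts i)

lemma measurable_residuals (hsample : IsObservedSample P μ X T Y Xs Ts Ys)
    (hmodel : LinearOutcomeModel P 𝒯 D X T Y ε σ g f β) (n : ℕ) :
    Measurable fun ω => fun i : Fin n => Ys i ω - predict f (β (Ts i ω)) (Xs i ω) :=
  measurable_pi_iff.2 fun i : Fin n => (measurable_residual hmodel.measurable_basis β).comp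
    ((hsample.measurable_Xs i).prodMk
      ((hsample.measurable_Ts i).prodMk (hsample.measurable_Ys i)))

variable [IsProbabilityMeasure P]

/-- Strong law of large numbers for the Gram matrix of a treatment group. -/
lemma ae_tendsto_groupGram (hsample : IsObservedSample P μ X T Y Xs Ts Ys)
    (hmodel : LinearOutcomeModel P 𝒯 D X T Y ε σ g f β) (t : 𝒯) :
    ∀ᵐ ω ∂μ, Tendsto (fun n : ℕ => (n : ℝ)⁻¹ •
        groupGram f (fun i : Fin n => Xs i ω) (fun i : Fin n => Ts i ω) t) atTop
      (𝓝 (gram (P.restrict (T ⁻¹' {t})) X f)) := by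
  have hT : MeasurableSet (T ⁻¹' {t}) := hmodel.measurable_T (measurableSet_singleton t)
  have hentry (j l : Fin p) : ∀ᵐ ω ∂μ, Tendsto (fun n : ℕ => ((n : ℝ)⁻¹ •
      groupGram f (fun i : Fin n => Xs i ω) (fun i : Fin n => Ts i ω) t) j l) atTop
      (𝓝 (gram (P.restrict (T ⁻¹' {t})) X f j l)) := by
    let h : EuclideanSpace ℝ (Fin d) × 𝒯 × ℝ → ℝ :=
      fun q => if q.2.1 = t then f j q.1 * f l q.1 else 0
    have hh : Measurable h :=
      Measurable.ite (measurable_snd.fst (measurableSet_singleton t))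
        (((hmodel.measurable_basis j).comp measurable_fst).mul
          ((hmodel.measurable_basis l).comp measurable_fst)) measurable_const
    let U (i : ℕ) (ω : Ω) : ℝ := h (Xs i ω, Ts i ω, Ys i ω)
    have hident (i : ℕ) : IdentDistrib (U i) (fun ω => h (X ω, T ω, Y (T ω) ω)) μ P :=
      (hsample.identDistrib i).comp hh
    have hpop : (fun ω => h (X ω, T ω, Y (T ω) ω))
        = (T ⁻¹' {t}).indicator fun ω => f j (X ω) * f l (X ω) := by
      ext ω
      by_cases hω : T ω = t <;> simp [h, Set.indicator, hω]
    have hint : Integrable (U 0) μ := by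
      rw [(hident 0).integrable_iff, hpop]
      exact (hmodel.integrable_basis_mul j l).indicator hT
    have hmean : ∫ ω, U 0 ω ∂μ = gram (P.restrict (T ⁻¹' {t})) X f j l := by
      rw [(hident 0).integral_eq, hpop, integral_indicator hT]
      rfl
    have hindep : iIndepFun U μ := hsample.indep.comp (fun _ => h) fun _ => hh
    have hslln := strong_law_ae_real U hint (fun i k hik => hindep.indepFun hik)
      fun i => (hident i).trans (hident 0).symm
    rw [hmean] at hslln
    filter_upwards [hslln] with ω hω
    refine hω.congr fun n => ?_
    rw [Finset.sum_range, div_eq_inv_mul]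
    rfl
  filter_upwards [ae_all_iff.2 fun j => ae_all_iff.2 fun l => hentry j l] with ω hω
  exact tendsto_pi_nhds.2 fun j => tendsto_pi_nhds.2 fun l => hω j l

lemma ae_eventually_fullRank (hsample : IsObservedSample P μ X T Y Xs Ts Ys)
    (hmodel : LinearOutcomeModel P 𝒯 D X T Y ε σ g f β) (hgram : IsUnit (gram P X f))
    (tk t0 : 𝒯) : ∀ᵐ ω ∂μ, ∀ᶠ n : ℕ in atTop,
      FullRank f tk t0 (fun i : Fin n => Xs i ω) (fun i : Fin n => Ts i ω) := by
  have hdet (t : 𝒯) := (hmodel.posDef_gram_restrict hgram t).det_pos.ne'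
  filter_upwards [hsample.ae_tendsto_groupGram hmodel tk,
    hsample.ae_tendsto_groupGram hmodel t0] with ω hk h0
  filter_upwards [eventually_det_ne_zero hk (hdet tk), eventually_det_ne_zero h0 (hdet t0)]
    with n h₁ h₂ using (fullRank_iff ..).2 ⟨h₁, h₂⟩

/-- The two factors `√n` combine to `n`, and `n A_t⁻¹ = (A_t / n)⁻¹` for large `n`, which converges.
The left side is the conditional variance in the direction `√n s`. -/
lemma ae_tendsto_dotProduct_inv_groupGram (hsample : IsObservedSample P μ X T Y Xs Ts Ys)
    (hmodel : LinearOutcomeModel P 𝒯 D X T Y ε σ g f β) (hgram : IsUnit (gram P X f))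
    (tk t0 : 𝒯) (s : EuclideanSpace ℝ (Fin p)) :
    ∀ᵐ ω ∂μ, Tendsto (fun n : ℕ => (σ : ℝ) ^ 2 * ((√(n : ℝ) • s).ofLp ⬝ᵥ
        (((groupGram f (fun i : Fin n => Xs i ω) (fun i : Fin n => Ts i ω) tk)⁻¹ +
          (groupGram f (fun i : Fin n => Xs i ω) (fun i : Fin n => Ts i ω) t0)⁻¹) *ᵥ
            (√(n : ℝ) • s).ofLp))) atTop
      (𝓝 (s.ofLp ⬝ᵥ (asymptoticCov P X T f σ tk t0 *ᵥ s.ofLp))) := by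
  have hdet (t : 𝒯) := (hmodel.posDef_gram_restrict hgram t).det_pos.ne'
  filter_upwards [hsample.ae_tendsto_groupGram hmodel tk,
    hsample.ae_tendsto_groupGram hmodel t0] with ω hk h0
  have h := ((tendsto_smul_inv hk (hdet tk)).add (tendsto_smul_inv h0 (hdet t0))).const_smul
    ((σ : ℝ) ^ 2)
  rw [← hmodel.asymptoticCov_eq hgram] at h
  have hcont : Continuous fun M : Matrix (Fin p) (Fin p) ℝ => s.ofLp ⬝ᵥ (M *ᵥ s.ofLp) := by
    fun_prop
  refine ((hcont.tendsto _).comp h).congr fun n => ?_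
  have hn : √(n : ℝ) * √(n : ℝ) = n := Real.mul_self_sqrt n.cast_nonneg
  simp only [Function.comp_apply, WithLp.ofLp_smul, Matrix.mulVec_smul, dotProduct_smul,
    smul_dotProduct, Matrix.smul_mulVec, ← smul_add, smul_eq_mul]
  rw [← mul_assoc (√(n : ℝ)), hn]

variable [IsProbabilityMeasure μ]

/-- Every estimator that agrees with the T-learner where the regressions are well posed is
unbiased there. -/
lemma isUnbiasedOn (hsample : IsObservedSample P μ X T Y Xs Ts Ys)
    (hmodel : LinearOutcomeModel P 𝒯 D X T Y ε σ g f β) (tk t0 : 𝒯)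
    {b : ℕ → Ω → EuclideanSpace ℝ (Fin p)} (hb : ∀ n, Measurable (b n))
    (hbT : ∀ (n : ℕ) ω, FullRank f tk t0 (fun i : Fin n => Xs i ω) (fun i : Fin n => Ts i ω) →
      b n ω = tCoef f tk t0 (fun i : Fin n => Xs i ω) (fun i : Fin n => Ts i ω)
        (fun i : Fin n => Ys i ω)) :
    IsUnbiasedOn μ (fun n ω => ((fun i : Fin n => Xs i ω), (fun i : Fin n => Ts i ω)))
      (fun n => {ω | FullRank f tk t0 (fun i : Fin n => Xs i ω) (fun i : Fin n => Ts i ω)}) b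
      (β tk - β t0) := by
  have hmean (n : ℕ) (z : (Fin n → EuclideanSpace ℝ (Fin d)) × (Fin n → 𝒯)) :
      Integrable (fun e => (β tk - β t0) + tCoef f tk t0 z.1 z.2 e)
          (Measure.pi fun _ : Fin n => gaussianReal 0 (σ ^ 2)) ∧
        ∫ e, ((β tk - β t0) + tCoef f tk t0 z.1 z.2 e)
          ∂(Measure.pi fun _ : Fin n => gaussianReal 0 (σ ^ 2)) = β tk - β t0 := by
    have h := integrable_tCoef_and_integral_eq_zero f tk t0 z.1 z.2 (σ ^ 2)
    refine ⟨(integrable_const _).add h.1, ?_⟩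
    rw [integral_add (integrable_const _) h.1, h.2, integral_const, probReal_univ, one_smul,
      add_zero]
  have hφ (n : ℕ) : Measurable
      fun q : ((Fin n → EuclideanSpace ℝ (Fin d)) × (Fin n → 𝒯)) × (Fin n → ℝ) =>
        (β tk - β t0) + tCoef f tk t0 q.1.1 q.1.2 q.2 :=
    (measurable_tCoef hmodel.measurable_basis measurable_fst.fst measurable_fst.snd
      measurable_snd tk t0).const_add _
  have hA (n : ℕ) : MeasurableSet
      {z : (Fin n → EuclideanSpace ℝ (Fin d)) × (Fin n → 𝒯) | FullRank f tk t0 z.1 z.2} :=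
    measurableSet_fullRank hmodel.measurable_basis measurable_fst measurable_snd tk t0
  exact isUnbiasedOn_of_indep hsample.measurable_design (hsample.measurable_residuals hmodel) hb
    hφ hA (hsample.map_design_residual_eq hmodel)
    (fun n ω hω => (hbT n ω hω).trans (tCoef_eq_add_noise hω _ β)) fun n z _ => hmean n z

/-- Every estimator that agrees with the T-learner where the regressions are well posed is
asymptotically normal. -/
lemma isAsymptoticallyNormal (hsample : IsObservedSample P μ X T Y Xs Ts Ys)
    (hmodel : LinearOutcomeModel P 𝒯 D X T Y ε σ g f β) (hgram : IsUnit (gram P X f))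
    {tk t0 : 𝒯} (hk : tk ≠ t0)
    {b : ℕ → Ω → EuclideanSpace ℝ (Fin p)} (hb : ∀ n, Measurable (b n))
    (hbT : ∀ (n : ℕ) ω, FullRank f tk t0 (fun i : Fin n => Xs i ω) (fun i : Fin n => Ts i ω) →
      b n ω = tCoef f tk t0 (fun i : Fin n => Xs i ω) (fun i : Fin n => Ts i ω)
        (fun i : Fin n => Ys i ω)) :
    IsAsymptoticallyNormal μ b (β tk - β t0) (asymptoticCov P X T f σ tk t0) := by
  refine isAsymptoticallyNormal_of_tendsto_conditional_charFun
    (ν := fun n => Measure.pi fun _ : Fin n => gaussianReal 0 (σ ^ 2))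
    (Z := fun n ω => ((fun i : Fin n => Xs i ω), (fun i : Fin n => Ts i ω)))
    (E := fun n ω (i : Fin n) => Ys i ω - predict f (β (Ts i ω)) (Xs i ω))
    (φ := fun n q => tCoef f tk t0 q.1.1 q.1.2 q.2)
    (hmodel.posSemidef_asymptoticCov hgram tk t0)
    hsample.measurable_design (hsample.measurable_residuals hmodel) hb
    (fun n => measurable_tCoef hmodel.measurable_basis measurable_fst.fst measurable_fst.snd
      measurable_snd tk t0)
    (hsample.map_design_residual_eq hmodel) ?_ fun s => ?_
  · filter_upwards [hsample.ae_eventually_fullRank hmodel hgram tk t0] with ω hω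
    filter_upwards [hω] with n hn
    rw [hbT n ω hn]
    exact tCoef_eq_add_noise hn _ β
  · filter_upwards [hsample.ae_eventually_fullRank hmodel hgram tk t0,
      hsample.ae_tendsto_dotProduct_inv_groupGram hmodel hgram tk t0 s] with ω hω hlim
    have hcont : Continuous fun q : ℝ => Complex.exp (-(q : ℂ) / 2) := by fun_prop
    refine ((hcont.tendsto _).comp hlim).congr' ?_
    filter_upwards [hω] with n hn
    have h := integral_exp_dotProduct_tCoef f hk _ _ hn (σ ^ 2) (√(n : ℝ) • s).ofLp
    simp only [EuclideanSpace.inner_eq_star_dotProduct, star_trivial]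
    rw [h, Function.comp_apply, NNReal.coe_pow]

end IsObservedSample

end Sample

end MetaLearner

/-! ### The main theorem. -/

open MetaLearner in
theorem theorem1 {Ω₀ Ω : Type*} [MeasurableSpace Ω₀] [MeasurableSpace Ω]
    (P : Measure Ω₀) [IsProbabilityMeasure P] (μ : Measure Ω) [IsProbabilityMeasure μ]
    {d p : ℕ} (𝒯 : Finset ℝ) (D : Set (EuclideanSpace ℝ (Fin d)))
    (X : Ω₀ → EuclideanSpace ℝ (Fin d)) (T : Ω₀ → 𝒯) (Y ε : 𝒯 → Ω₀ → ℝ) (σ : ℝ≥0)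
    (g : ℝ → EuclideanSpace ℝ (Fin d) → ℝ) (f : Fin p → EuclideanSpace ℝ (Fin d) → ℝ)
    (β : 𝒯 → EuclideanSpace ℝ (Fin p))
    (hmodel : LinearOutcomeModel P 𝒯 D X T Y ε σ g f β)
    (hgram : IsUnit (gram P X f))
    (Xs : ℕ → Ω → EuclideanSpace ℝ (Fin d)) (Ts : ℕ → Ω → 𝒯) (Ys : ℕ → Ω → ℝ)
    (hsample : IsObservedSample P μ X T Y Xs Ts Ys)
    (tk t0 : 𝒯) (hk : tk ≠ t0)
    -- the propensity estimates used by the naive X-learner, possibly data-dependent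
    (rhat : ℕ → Ω → 𝒯 → EuclideanSpace ℝ (Fin d) → ℝ)
    (hrhat_meas : ∀ n t x, Measurable fun ω => rhat n ω t x)
    (hrhat_pos : ∀ n ω t, ∀ x ∈ D, 0 < rhat n ω t x) :
    let x : ∀ n, Ω → Fin n → EuclideanSpace ℝ (Fin d) := fun _ ω i => Xs i ω
    let w : ∀ n, Ω → Fin n → 𝒯 := fun _ ω i => Ts i ω
    let y : ∀ n, Ω → Fin n → ℝ := fun _ ω i => Ys i ω
    let design : ∀ n, Ω → (Fin n → EuclideanSpace ℝ (Fin d)) × (Fin n → 𝒯) :=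
      fun n ω => (x n ω, w n ω)
    let G : ℕ → Set Ω := fun n => {ω | FullRank f tk t0 (x n ω) (w n ω)}
    let bT : ℕ → Ω → EuclideanSpace ℝ (Fin p) :=
      fun n ω => tCoef f tk t0 (x n ω) (w n ω) (y n ω)
    let bk : ℕ → Ω → EuclideanSpace ℝ (Fin p) :=
      fun n ω => xCoefTreated f tk t0 (x n ω) (w n ω) (y n ω)
    let b0 : ℕ → Ω → EuclideanSpace ℝ (Fin p) :=
      fun n ω => xCoefControl f tk t0 (x n ω) (w n ω) (y n ω)
    let bX : EuclideanSpace ℝ (Fin d) → ℕ → Ω → EuclideanSpace ℝ (Fin p) :=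
      fun v n ω => xCoef f tk t0 (rhat n ω) (x n ω) (w n ω) (y n ω) v
    let βstar : EuclideanSpace ℝ (Fin p) := β tk - β t0
    let C : Matrix (Fin p) (Fin p) ℝ := asymptoticCov P X T f σ tk t0
    -- `βstar` is the coefficient vector of the CATE
    (P[fun ω => Y tk ω - Y t0 ω | MeasurableSpace.comap X inferInstance]
        =ᵐ[P] fun ω => predict f βstar (X ω)) ∧
    -- almost surely, the regressions are well posed for all large sample sizes
    (∀ᵐ ω ∂μ, ∀ᶠ n in atTop, ω ∈ G n) ∧
    -- the T-learner and the naive X-learner coincide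
    (∀ n, ∀ ω ∈ G n, bk n ω = bT n ω ∧ b0 n ω = bT n ω ∧
      ∀ v ∈ D, bX v n ω = bT n ω ∧
        xCATE f tk t0 (rhat n ω) (x n ω) (w n ω) (y n ω) v = predict f (bT n ω) v ∧
        tCATE f tk t0 (x n ω) (w n ω) (y n ω) v = predict f (bT n ω) v) ∧
    -- unbiasedness
    (IsUnbiasedOn μ design G bT βstar ∧ IsUnbiasedOn μ design G bk βstar ∧
      IsUnbiasedOn μ design G b0 βstar ∧ ∀ v ∈ D, IsUnbiasedOn μ design G (bX v) βstar) ∧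
    -- asymptotic normality
    (IsAsymptoticallyNormal μ bT βstar C ∧ IsAsymptoticallyNormal μ bk βstar C ∧
      IsAsymptoticallyNormal μ b0 βstar C ∧ ∀ v ∈ D, IsAsymptoticallyNormal μ (bX v) βstar C) ∧
    -- the quantities that define `C` make sense, and its entries are bounded
    ((∀ t, 0 < rho P T t) ∧ (condGram P X T f tk).PosDef ∧ (condGram P X T f t0).PosDef ∧
      ∀ c : ℝ, 0 < c → (condGram P X T f tk - c • 1).PosSemidef →
        (condGram P X T f t0 - c • 1).PosSemidef →
        ∀ i j, |C i j| ≤ (σ : ℝ) ^ 2 / c * (1 / rho P T tk + 1 / rho P T t0)) := by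
  intro x w y design G bT bk b0 bX βstar C
  have hf := hmodel.measurable_basis
  have hx (n : ℕ) : Measurable (x n) := measurable_pi_iff.2 fun i => hsample.measurable_Xs i
  have hw (n : ℕ) : Measurable (w n) := measurable_pi_iff.2 fun i => hsample.measurable_Ts i
  have hy (n : ℕ) : Measurable (y n) := measurable_pi_iff.2 fun i => hsample.measurable_Ys i
  have hbT (n : ℕ) : Measurable (bT n) := measurable_tCoef hf (hx n) (hw n) (hy n) tk t0
  have hbk (n : ℕ) : Measurable (bk n) := measurable_xCoefTreated hf (hx n) (hw n) (hy n) tk t0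
  have hb0 (n : ℕ) : Measurable (b0 n) := measurable_xCoefControl hf (hx n) (hw n) (hy n) tk t0
  have hbX (v : EuclideanSpace ℝ (Fin d)) (n : ℕ) : Measurable (bX v n) :=
    measurable_xCoef hf (hx n) (hw n) (hy n) tk t0 fun t => hrhat_meas n t v
  -- Measurability and equality with `bT` on `G n` are all that the unbiasedness and normality
  -- lemmas require of an estimator.
  have ek (n : ℕ) (ω : Ω) (hω : ω ∈ G n) : bk n ω = bT n ω := xCoefTreated_eq_tCoef hω _
  have e0 (n : ℕ) (ω : Ω) (hω : ω ∈ G n) : b0 n ω = bT n ω := xCoefControl_eq_tCoef hω _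
  have eX (v) (hv : v ∈ D) (n : ℕ) (ω : Ω) (hω : ω ∈ G n) : bX v n ω = bT n ω :=
    xCoef_eq_tCoef hω _ fun t => hrhat_pos n ω t v hv
  refine ⟨hmodel.condExp_sub_ae_eq_predict tk t0, hsample.ae_eventually_fullRank hmodel hgram tk t0,
    fun n ω hω => ⟨ek n ω hω, e0 n ω hω, fun v hv => ⟨eX v hv n ω hω,
      xCATE_eq_predict hω _ fun t => hrhat_pos n ω t v hv, tCATE_eq_predict ..⟩⟩,
    ⟨hsample.isUnbiasedOn hmodel tk t0 hbT fun _ _ _ => rfl,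
      hsample.isUnbiasedOn hmodel tk t0 hbk ek, hsample.isUnbiasedOn hmodel tk t0 hb0 e0,
      fun v hv => hsample.isUnbiasedOn hmodel tk t0 (hbX v) (eX v hv)⟩,
    ⟨hsample.isAsymptoticallyNormal hmodel hgram hk hbT fun _ _ _ => rfl,
      hsample.isAsymptoticallyNormal hmodel hgram hk hbk ek,
      hsample.isAsymptoticallyNormal hmodel hgram hk hb0 e0,
      fun v hv => hsample.isAsymptoticallyNormal hmodel hgram hk (hbX v) (eX v hv)⟩,
    hmodel.rho_pos, hmodel.posDef_condGram hgram tk, hmodel.posDef_condGram hgram t0,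
    fun c hc hck hc0 i j => hmodel.abs_asymptoticCov_apply_le hgram tk t0 hc hck hc0 i j⟩
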